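/- Let $c$ and $a$ be fixed non-negative integers. Consider a network: a finite simple graph $G=(V,E)$ on $n$ vertices (processors) with distinct IDs in $\{0,\dots,n^a-1\}$, in which a subset of the vertices is active. Assume that the neighborhood independence of $G$ is at most $c$ (no neighborhood $\Gamma(v)$ contains an independent set of more than $c$ vertices), and that every active vertex has degree at least $K$, where $K\ge 1$ is an integer. Computation is deterministic and takes place in the $\mathcal{CONGEST}$ model: in each synchronous round every vertex sends to each of its neighbors a message of $O(\log n)$ bits. All vertices know $n$, $K$, $a$ and $c$; otherwise a vertex initially knows only its own ID, the IDs of its neighbors, whether it is active, and its own data, which consist of a word of at most $\lfloor\log_2 n\rfloor$ bits for each backup node. Procedure Efficient-VM works as follows. 1. *$K$-Next-Modulo.* In a single round, every active vertex $v$ selects the set $BP(v)$ of the $K$ neighbors that immediately succeed $v$ in the circular order of IDs. Let $G'=(V,E')$ be the graph of the selected edges $\{v,u\}$, $u\in BP(v)$. 2. *2-hop coloring.* The vertices of $G'$ are colored, so that any two distinct vertices at distance at most $2$ in $G'$ get distinct colors, by Linial's algorithm. Starting from the IDs as colors, it performs iterated color reduction on the graph that joins distinct vertices at distance at most $2$ in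 $G'$. In each step there is a system of sets $F_x$ of new colors, one for each old color $x$, such that no $F_x$ is covered by $D=((c+1)K)^2$ others, and a vertex of color $x$ takes the least new color in $F_x$ that is in no set $F_y$ of a color $y$ of one of its neighbors in that graph. The set systems depend only on $n,K,a,c$. 3. *Round-robin.* The color classes have their turns one after the other, one round each; in the turn of a color, the active vertices $v$ of this color send their data to the vertices of $BP(v)$. In its turn a vertex $v$ uses its own memory and the memories of the vertices in $BP(v)$; outside their turns, vertices use no memory. **Theorem.** The set systems for step 2 can be chosen so that $O(K^4)$ colors are used and Efficient-VM is carried out by a program in the $\mathcal{CONGEST}$ model within $O(\log^* n+K^4)$ rounds in total (all three steps together), where the constants in the $O$-notation, including the one for the message length, depend only on $c$ and $a$. The coloring is a legal 2-hop coloring of $G'$. Every active vertex $v$ selects exactly $K$ neighbors, and in the turn of $v$ no other vertex uses the memory of any of them. Hence, if every vertex has a memory of size $M$, then in its turn $v$ has, besides its own memory, $K\cdot M$ units of memory of its neighbors exclusively for itself, so that its virtual memory is $M+K\cdot M$. -/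

import Mathlib

open Finset

/-- The iterated logarithm `log* n`: the number of times the base-two logarithm has to be applied
to `n` before the value is at most `1`. (Rounding every logarithm up does not change the count.) -/
def logStar (n : ℕ) : ℕ :=
  if h : n ≤ 1 then 0 else 1 + logStar (Nat.clog 2 n)
termination_by n
decreasing_by
  have h2 : n - 1 < 2 ^ (n - 1) := Nat.lt_two_pow_self
  have h3 : Nat.clog 2 n ≤ n - 1 := Nat.clog_le_of_le_pow (by omega)
  omega

/-! ### Graph notions -/

/-- Neighborhood independence: the maximum size of an independent set that is contained in the
neighborhood of a vertex. -/
noncomputable def neighborhoodIndependence {V : Type*} (G : SimpleGraph V) : ℕ :=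
  sSup {k | ∃ (v : V) (S : Finset V),
    (S : Set V) ⊆ G.neighborSet v ∧ G.IsIndepSet (S : Set V) ∧ S.card = k}

/-- The graph that joins any two distinct vertices at distance at most `t` in `G`. -/
def hopGraph {V : Type*} (G : SimpleGraph V) (t : ℕ) : SimpleGraph V where
  Adj u v := u ≠ v ∧ G.edist u v ≤ t
  symm := ⟨fun u v h => ⟨h.1.symm, by rw [SimpleGraph.edist_comm]; exact h.2⟩⟩
  loopless := ⟨fun _ h => h.1 rfl⟩

/-- A legal `t`-hop coloring with `α` colors: distinct vertices at distance at most `t` get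
distinct colors. -/
def IsHopColoring {V : Type*} (G : SimpleGraph V) (t α : ℕ) (φ : V → ℕ) : Prop :=
  (∀ v, φ v < α) ∧ ∀ u v, u ≠ v → G.edist u v ≤ t → φ u ≠ φ v

/-! ### Networks and the selection of backup nodes -/

/-- A network: a communication graph whose vertices carry distinct IDs, some of them being active
(that is, asking for the memory of their neighbors). -/
structure Network (V : Type*) where
  graph : SimpleGraph V
  id : V → ℕ
  id_injective : Function.Injective id
  active : V → Bool

/-- `K`-Next-Modulo, from the ID `i` of a vertex and the set `Γ` of the IDs of its neighbors: sort
the neighbors by ID as a circular list, begin with the first one whose ID exceeds `i` (with the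
smallest one if there is none), and take `K` consecutive entries. -/
def kNextModulo (K i : ℕ) (Γ : Finset ℕ) : List ℕ :=
  ((Γ.filter (fun j => i < j)).sort (· ≤ ·) ++ (Γ.filter (fun j => j < i)).sort (· ≤ ·)).take K

namespace Network

variable {V : Type*} [Fintype V]

open Classical in
/-- The IDs of the neighbors of `v`. -/
noncomputable def neighborIds (N : Network V) (v : V) : Finset ℕ :=
  (univ.filter (fun u => N.graph.Adj v u)).image N.id

/-- The backup nodes `v.BP`: an active vertex selects by `K`-Next-Modulo, other vertices select
nothing. -/
noncomputable def backup (N : Network V) (K : ℕ) (v : V) : Finset V :=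
  univ.filter (fun u => N.active v = true ∧ N.id u ∈ kNextModulo K (N.id v) (N.neighborIds v))

/-- The selection subgraph `G' = (V, E')`, whose edges join a vertex to the vertices it selects. -/
noncomputable def selectionGraph (N : Network V) (K : ℕ) : SimpleGraph V :=
  SimpleGraph.fromRel (fun v u => u ∈ N.backup K v)

end Network

/-! ### Linial's coloring algorithm -/

/-- The data of Linial's color reduction for graphs of maximum degree at most `D` that are
initially colored with the `m` colors `0, …, m - 1`: a number of steps, the palette size before and
after each step, and for each step a set system, indexed by the old colors and consisting of sets
of new colors, in which no set is covered by `D` others. -/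
structure LinialScheme (D m : ℕ) where
  steps : ℕ
  palette : ℕ → ℕ
  palette_zero : palette 0 = m
  family : ℕ → ℕ → Finset ℕ
  family_subset : ∀ i < steps, ∀ x < palette i, family i x ⊆ range (palette (i + 1))
  cover_free : ∀ i < steps, ∀ x < palette i, ∀ S ⊆ range (palette i),
    S.card ≤ D → x ∉ S → ¬ family i x ⊆ S.biUnion (family i)

namespace LinialScheme

variable {D m : ℕ} {V : Type*}

/-- The number of colors at the end. -/
def numColors (S : LinialScheme D m) : ℕ := S.palette S.steps

/-- The coloring of `H` after `i` steps, from the initial coloring `φ`. In each step every vertex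
picks the least element of the set of its color that lies in none of the sets of the colors of its
neighbors. -/
noncomputable def colorAfter (S : LinialScheme D m) (H : SimpleGraph V) (φ : V → ℕ) :
    ℕ → V → ℕ
  | 0 => φ
  | i + 1 => fun v =>
      sInf {x | x ∈ S.family i (colorAfter S H φ i v) ∧
        ∀ u, H.Adj v u → x ∉ S.family i (colorAfter S H φ i u)}

/-- The final coloring of `H`. -/
noncomputable def color (S : LinialScheme D m) (H : SimpleGraph V) (φ : V → ℕ) : V → ℕ :=
  S.colorAfter H φ S.steps

end LinialScheme

/-- The coloring computed in procedure Efficient-VM: Linial's algorithm, run from the IDs, on the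
square of the selection subgraph. -/
noncomputable def Network.vmColor {V : Type*} [Fintype V] (N : Network V) (K : ℕ) {D m : ℕ}
    (S : LinialScheme D m) : V → ℕ :=
  S.color (hopGraph (N.selectionGraph K) 2) N.id

/-- The vertices that use memory in the turn of the color class `j`. -/
def Network.colorClass {V : Type*} (N : Network V) (φ : V → ℕ) (j : ℕ) : Set V :=
  {v | N.active v = true ∧ φ v = j}

/-! ### Virtual memory -/

/-- A vertex in its turn uses its own memory and the memories of its backup nodes. -/
def UsesMemory {V : Type*} (BP : V → Finset V) (v u : V) : Prop :=
  u = v ∨ u ∈ BP v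

open Classical in
/-- The virtual memory of `v` while the vertices in `turn` have their turn: the total size of the
memories that `v` uses and that no other vertex in `turn` uses. Here `mem u` is the size of the
physical memory of `u`. -/
noncomputable def virtualMemory {V : Type*} [Fintype V] (mem : V → ℕ) (turn : Set V)
    (BP : V → Finset V) (v : V) : ℕ :=
  ∑ u ∈ univ.filter (fun u => v ∈ turn ∧ UsesMemory BP v u ∧
    ∀ w ∈ turn, UsesMemory BP w u → w = v), mem u

/-! ### Synchronous message passing -/

/-- What a node knows at the beginning: its own ID, the IDs of its neighbors, whether it is active,
and the word that it wants to store at the node with a given ID. -/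
structure LocalInput where
  id : ℕ
  neighborIds : Finset ℕ
  active : Bool
  data : ℕ → List Bool

/-- A deterministic program that all nodes run. Neighbors are addressed by their IDs, and in each
round a node sends to each of its neighbors a bit string or nothing (`none`), then updates its
state from the messages that arrive. The last two fields read off the state the IDs of the selected
backup nodes and the color. -/
structure NodeProgram where
  State : Type
  init : LocalInput → State
  send : State → ℕ → Option (List Bool)
  receive : State → (ℕ → Option (List Bool)) → State
  selected : State → Finset ℕ
  color : State → ℕ

namespace NodeProgram

variable {V : Type*} [Fintype V]

open Classical in
/-- The state of each node after `t` rounds. -/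
noncomputable def run (P : NodeProgram) (N : Network V) (data : V → ℕ → List Bool) :
    ℕ → V → P.State
  | 0 => fun v => P.init ⟨N.id v, N.neighborIds v, N.active v, data v⟩
  | t + 1 => fun v =>
      P.receive (run P N data t v) (fun i =>
        if h : ∃ u, N.graph.Adj v u ∧ N.id u = i then
          P.send (run P N data t h.choose) (N.id v)
        else none)

/-- The message that `v` sends to `u` in the round that follows the first `t` rounds. -/
noncomputable def message (P : NodeProgram) (N : Network V) (data : V → ℕ → List Bool)
    (t : ℕ) (v u : V) : Option (List Bool) :=
  P.send (P.run N data t v) (N.id u)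

/-- Every message that is sent along an edge has at most `b` bits. -/
def BandwidthLE (P : NodeProgram) (N : Network V) (data : V → ℕ → List Bool) (b : ℕ) : Prop :=
  ∀ (t : ℕ) (v u : V), N.graph.Adj v u → ∀ w ∈ P.message N data t v u, w.length ≤ b

open Classical in
/-- The program `P` carries out procedure Efficient-VM on `N`, with `T` rounds before the color
classes take turns: the selection by `K`-Next-Modulo is made in the first round; after `T` rounds
every vertex has its color; and from then on the messages are exactly those of the round-robin, in
which the active vertices of color `j` send their data to their backup nodes in the `j`-th of the
remaining rounds. In particular no message is sent after all the classes have had their turn. -/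
def CarriesOutVM (P : NodeProgram) (N : Network V) (data : V → ℕ → List Bool) (K : ℕ)
    {D m : ℕ} (S : LinialScheme D m) (T : ℕ) : Prop :=
  (∀ t, 1 ≤ t → ∀ v, P.selected (P.run N data t v) = (N.backup K v).image N.id) ∧
  (∀ t, T ≤ t → ∀ v, P.color (P.run N data t v) = N.vmColor K S v) ∧
  ∀ t v u, T ≤ t → N.graph.Adj v u →
    P.message N data t v u =
      if v ∈ N.colorClass (N.vmColor K S) (t - T) ∧ u ∈ N.backup K v then
        some (data v (N.id u))
      else none

end NodeProgram

/-!
Three facts carry the theorem.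

*Few conflicts.* Let `W` be the set of vertices that select `u`, arranged in the circular order of
IDs that ends at `u`. A vertex of `W` has fewer than `K` later neighbors in `W`, since these lie
between it and `u` and would be selected before `u`. Greedily, `W` contains an independent set of
`|W| / K` vertices, all of them neighbors of `u`, so `|W| ≤ c * K`
(`Network.card_filter_mem_backup_le`). Hence the selection graph has maximum degree at most `Δ =
(c + 1) * K`, its square has maximum degree at most `D = Δ ^ 2`, and Linial's algorithm stays
legal on the square (`LinialScheme.colorAfter_legal`). Two vertices that use the memory of a
common vertex are at distance at most `2`, so a legal 2-hop coloring makes the use of memory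
exclusive (`Network.eq_of_usesMemory`).

*Few steps with short colors.* The graphs of polynomials of degree at most `d` over a field with
more than `d * D` elements form a cover-free system. With `d = log m` one step leads from `m` to
`O(D ^ 2 * log m ^ 2)` colors, and `d = 3` is used for the last step, to `O(D ^ 2) = O(K ^ 4)`
colors. There are `O(log* m)` steps, and the color lengths at least halve in all but the last two
of them, so that the color lengths of all steps sum to `O(log m)` (`LinialScheme.exists_scheme`).

*Few rounds.* For a step on the square of the selection graph every vertex has to pass on the
colors of its neighbors, up to `Δ + 1` of them. Messages of `log n` bits do not carry so many IDs,
and `O(K)` rounds for each step would be too many. But a word of `l` bits needs only `1 + l / log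
n` rounds, and the lengths `l` of all words of the whole reduction sum to `O(K * log n)`, so that
the long words cost `O(K)` additional rounds in total (`sum_phaseRounds_le`). The program is
therefore described as an algorithm in phases with words of arbitrary length (`vmAlgorithm`),
whose execution by messages of bounded length is treated once and for all
(`PhasedAlgorithm.run_toProgram`).
-/

/-! ### The iterated logarithm -/

lemma logStar_of_le_one {n : ℕ} (h : n ≤ 1) : logStar n = 0 := by
  rw [logStar, dif_pos h]

lemma logStar_of_one_lt {n : ℕ} (h : 1 < n) : logStar n = 1 + logStar (Nat.clog 2 n) := by
  rw [logStar, dif_neg (by omega)]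

lemma clog_two_lt_self {n : ℕ} (h : 1 < n) : Nat.clog 2 n < n := by
  have h2 : n - 1 < 2 ^ (n - 1) := Nat.lt_two_pow_self
  have h3 : Nat.clog 2 n ≤ n - 1 := Nat.clog_le_of_le_pow (by omega)
  omega

lemma logStar_mono : Monotone logStar := by
  intro n
  induction n using Nat.strong_induction_on with
  | _ n ih =>
    intro m h
    by_cases hn : n ≤ 1
    · rw [logStar_of_le_one hn]
      exact Nat.zero_le _
    · rw [logStar_of_one_lt (by omega), logStar_of_one_lt (by omega : 1 < m)]
      exact Nat.add_le_add_left
        (ih _ (clog_two_lt_self (by omega)) (Nat.clog_mono_right 2 h)) 1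

lemma logStar_two_pow_le (x : ℕ) : logStar (2 ^ x) ≤ 1 + logStar x := by
  rcases Nat.eq_zero_or_pos x with rfl | hx
  · rw [logStar_of_le_one (by simp)]
    exact Nat.zero_le _
  · rw [logStar_of_one_lt (Nat.one_lt_two_pow (by omega)), Nat.clog_pow _ _ (by norm_num)]

/-- Raising to a fixed power changes the iterated logarithm by an additive constant only. -/
lemma logStar_pow_le (n a : ℕ) : logStar (n ^ a) ≤ 3 + logStar n + logStar a := by
  by_cases h1 : n ^ a ≤ 1
  · rw [logStar_of_le_one h1]
    exact Nat.zero_le _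
  have hn : 1 < n := by
    by_contra hn
    exact h1 (pow_le_one₀ (Nat.zero_le _) (by omega))
  rw [logStar_of_one_lt (by omega : 1 < n ^ a), logStar_of_one_lt hn]
  set x := Nat.clog 2 n
  have hclog : Nat.clog 2 (n ^ a) ≤ x * a := by
    refine Nat.clog_le_of_le_pow ?_
    rw [pow_mul]
    exact Nat.pow_le_pow_left (Nat.le_pow_clog (by norm_num) n) a
  have hdouble : ∀ y : ℕ, y * y ≤ 2 ^ 2 ^ y := by
    intro y
    rcases Nat.eq_zero_or_pos y with rfl | hy
    · simp
    have h2 : 2 * y ≤ 2 ^ y := by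
      obtain ⟨z, rfl⟩ : ∃ z, y = z + 1 := ⟨y - 1, by omega⟩
      have : z < 2 ^ z := Nat.lt_two_pow_self
      rw [pow_succ]
      omega
    calc y * y ≤ 2 ^ y * 2 ^ y := Nat.mul_le_mul Nat.lt_two_pow_self.le Nat.lt_two_pow_self.le
      _ = 2 ^ (2 * y) := by rw [two_mul, pow_add]
      _ ≤ 2 ^ 2 ^ y := Nat.pow_le_pow_right (by norm_num) h2
  have hle : Nat.clog 2 (n ^ a) ≤ 2 ^ 2 ^ max x a :=
    hclog.trans ((Nat.mul_le_mul (le_max_left _ _) (le_max_right _ _)).trans (hdouble _))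
  have h3 := (logStar_mono hle).trans (logStar_two_pow_le _)
  have h4 := logStar_two_pow_le (max x a)
  have h5 : logStar (max x a) ≤ logStar x + logStar a := by
    rcases le_total x a with h | h
    · rw [max_eq_right h]; omega
    · rw [max_eq_left h]; omega
  omega

/-- One reduction step turns `m` colors with `L = clog m` into at most `4 L ^ 4`. Once `L` is large,
two such steps lead below `L`, and a single one already halves `L`. -/
lemma exists_forall_clog_pow_le : ∃ L₀ : ℕ, ∀ L, L₀ < L →
    4 * Nat.clog 2 (4 * L ^ 4) ^ 4 ≤ L ∧ 2 * Nat.clog 2 (4 * L ^ 4) ≤ L := by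
  have key : ∀ k, 40 ≤ k → 4 * (2 + 4 * (k + 1)) ^ 4 ≤ 2 ^ k := by
    intro k hk
    induction k, hk using Nat.le_induction with
    | base => norm_num
    | succ k hk ih =>
      refine le_trans ?_ ((Nat.mul_le_mul_right 2 ih).trans (pow_succ 2 k).ge)
      -- The base grows by a factor of at most `11 / 10`, and `(11 / 10) ^ 4 ≤ 2`.
      have h1 : 10 * (2 + 4 * (k + 1 + 1)) ≤ 11 * (2 + 4 * (k + 1)) := by omega
      have h2 := Nat.pow_le_pow_left h1 4
      rw [mul_pow, mul_pow] at h2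
      omega
  refine ⟨2 ^ 40, fun L hL => ?_⟩
  set x := Nat.clog 2 (4 * L ^ 4) with hx
  set k := Nat.clog 2 L - 1 with hk
  have hL1 : 40 < Nat.clog 2 L := (Nat.lt_clog_iff_pow_lt (by norm_num)).2 hL
  have hkL : 2 ^ k < L := Nat.pow_lt_of_lt_clog (by omega)
  have hxle : x ≤ 2 + 4 * (k + 1) := by
    refine Nat.clog_le_of_le_pow ?_
    have h1 : L ≤ 2 ^ (k + 1) := by
      rw [hk, Nat.sub_add_cancel (by omega)]
      exact Nat.le_pow_clog (by norm_num) L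
    calc 4 * L ^ 4 ≤ 4 * (2 ^ (k + 1)) ^ 4 := Nat.mul_le_mul_left _ (Nat.pow_le_pow_left h1 4)
      _ = 2 ^ (2 + 4 * (k + 1)) := by
        rw [← pow_mul, pow_add 2 2, mul_comm (k + 1)]
        norm_num
  have h4 : 4 * x ^ 4 ≤ L :=
    (Nat.mul_le_mul_left 4 (Nat.pow_le_pow_left hxle 4)).trans ((key k (by omega)).trans hkL.le)
  have h5 : x ≤ x ^ 4 := Nat.le_self_pow (by norm_num) x
  exact ⟨h4, by omega⟩

/-! ### Cover-free set systems and the schedule of palettes -/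

/-- Set systems from polynomials: the graphs of distinct polynomials of degree at most `d` over the
field with `q` elements meet in at most `d` of their `q` points, so that `D` of them cannot cover
another one if `d * D < q`. -/
lemma exists_coverFree_family {q d D m : ℕ} (hq : q.Prime) (hd : d * D < q)
    (hm : m ≤ q ^ (d + 1)) :
    ∃ F : ℕ → Finset ℕ, (∀ x, F x ⊆ range (q ^ 2)) ∧
      ∀ x < m, ∀ S ⊆ range m, S.card ≤ D → x ∉ S → ¬ F x ⊆ S.biUnion F := by
  classical
  have : Fact q.Prime := ⟨hq⟩
  have hcard : Fintype.card (Fin m) ≤ Fintype.card (Fin (d + 1) → ZMod q) := by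
    simpa [ZMod.card] using hm
  obtain ⟨e⟩ := Function.Embedding.nonempty_of_card_le hcard
  let p : ℕ → Polynomial (ZMod q) := fun x =>
    if h : x < m then ((Polynomial.degreeLTEquiv (ZMod q) (d + 1)).symm (e ⟨x, h⟩) :
      Polynomial (ZMod q)) else 0
  have hpdeg : ∀ x, (p x).natDegree ≤ d := by
    intro x
    by_cases h : x < m
    · simp only [p, dif_pos h]
      have := Polynomial.mem_degreeLT.1
        ((Polynomial.degreeLTEquiv (ZMod q) (d + 1)).symm (e ⟨x, h⟩)).property
      rw [Polynomial.degree_lt_iff_coeff_zero] at this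
      exact Polynomial.natDegree_le_iff_coeff_eq_zero.2 fun N hN => this N hN
    · simp [p, dif_neg h]
  have hpinj : ∀ x < m, ∀ y < m, p x = p y → x = y := by
    intro x hx y hy h
    simp only [p, dif_pos hx, dif_pos hy] at h
    have := e.injective ((Polynomial.degreeLTEquiv (ZMod q) (d + 1)).symm.injective
      (Subtype.ext h))
    simpa using this
  -- `pt x t` encodes the point of the graph of `p x` over `t` as a number below `q ^ 2`.
  let pt : ℕ → ZMod q → ℕ := fun x t => q * t.val + ((p x).eval t).val
  have hpt : ∀ x y s t, pt x s = pt y t → s = t ∧ (p x).eval s = (p y).eval t := by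
    intro x y s t h
    have h1 : ((p x).eval s).val < q := ZMod.val_lt _
    have h2 : ((p y).eval t).val < q := ZMod.val_lt _
    have hst : s.val = t.val := by
      have h3 := congrArg (· / q) h
      simpa [pt, Nat.mul_add_div hq.pos, Nat.div_eq_of_lt h1, Nat.div_eq_of_lt h2] using h3
    refine ⟨ZMod.val_injective q hst, ZMod.val_injective q ?_⟩
    simp only [pt, hst] at h
    omega
  refine ⟨fun x => univ.image (pt x), fun x => ?_, fun x hx S hS hSD hxS hcov => ?_⟩
  · intro z hz
    obtain ⟨t, -, rfl⟩ := mem_image.1 hz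
    have h1 : ((p x).eval t).val < q := ZMod.val_lt _
    have h2 : t.val < q := ZMod.val_lt _
    rw [mem_range]
    simp only [pt]
    nlinarith
  · -- If the graphs indexed by `S` covered that of `p x`, every `t` would be a root of some
    -- `p x - p y` with `y ∈ S`; these have at most `d * D < q` roots in total.
    have hroots : (univ : Finset (ZMod q)) ⊆
        S.biUnion (fun y => (p x - p y).roots.toFinset) := by
      intro t _
      obtain ⟨y, hyS, hy⟩ := mem_biUnion.1 (hcov (mem_image_of_mem (pt x) (mem_univ t)))
      obtain ⟨s, -, hs⟩ := mem_image.1 hy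
      obtain ⟨rfl, h2⟩ := hpt _ _ _ _ hs
      refine mem_biUnion.2 ⟨y, hyS, ?_⟩
      rw [Multiset.mem_toFinset, Polynomial.mem_roots']
      refine ⟨fun h0 => hxS ?_, ?_⟩
      · rw [hpinj x hx y (mem_range.1 (hS hyS)) (sub_eq_zero.1 h0)]
        exact hyS
      · rw [Polynomial.IsRoot, Polynomial.eval_sub, h2, sub_self]
    have hle : ∀ y ∈ S, (p x - p y).roots.toFinset.card ≤ d := by
      intro y _
      refine (Multiset.toFinset_card_le _).trans ((Polynomial.card_roots' _).trans ?_)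
      exact Polynomial.natDegree_sub_le_of_le (hpdeg x) (hpdeg y) |>.trans (max_self d).le
    have h1 := (card_le_card hroots).trans (card_biUnion_le_card_mul S _ d hle)
    rw [card_univ, ZMod.card] at h1
    have h2 : S.card * d ≤ d * D := by
      rw [mul_comm]
      exact Nat.mul_le_mul_left d hSD
    omega

namespace LinialScheme

variable {D m m' : ℕ}

/-- The scheme without steps. -/
def trivial (D m : ℕ) : LinialScheme D m where
  steps := 0
  palette _ := m
  palette_zero := rfl
  family _ _ := ∅
  family_subset i hi := absurd hi (Nat.not_lt_zero i)
  cover_free i hi := absurd hi (Nat.not_lt_zero i)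

/-- The scheme that begins with one step from `m` to `m'` colors and goes on with the scheme `S`. -/
def cons (F : ℕ → Finset ℕ) (hF : ∀ x < m, F x ⊆ range m')
    (hcov : ∀ x < m, ∀ T ⊆ range m, T.card ≤ D → x ∉ T → ¬ F x ⊆ T.biUnion F)
    (S : LinialScheme D m') : LinialScheme D m where
  steps := S.steps + 1
  palette i := Nat.casesOn i m S.palette
  palette_zero := rfl
  family i := Nat.casesOn i F S.family
  family_subset i hi := by
    cases i with
    | zero =>
      change ∀ x < m, F x ⊆ range (S.palette 0)
      rwa [S.palette_zero]
    | succ i => exact S.family_subset i (by omega)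
  cover_free i hi := by
    cases i with
    | zero => exact hcov
    | succ i => exact S.cover_free i (by omega)

/-- The sum, over all steps, of the number of bits of one color before the step. -/
def totalBits (S : LinialScheme D m) : ℕ := ∑ i ∈ range S.steps, Nat.clog 2 (S.palette i)

/-- One step of color reduction by polynomials of degree at most `d`, whose field size is found by
Bertrand's postulate, put in front of a scheme. -/
lemma exists_cons {s d : ℕ} (hs : s ≠ 0) (hd : d * D ≤ s) (hm : m ≤ s ^ (d + 1)) :
    ∃ m' ≤ (2 * s) ^ 2, ∀ S : LinialScheme D m', ∃ S' : LinialScheme D m,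
      S'.numColors = S.numColors ∧ S'.steps = S.steps + 1 ∧
      S'.totalBits = Nat.clog 2 m + S.totalBits := by
  obtain ⟨q, hq, hsq, hq2⟩ := Nat.exists_prime_lt_and_le_two_mul s hs
  obtain ⟨F, hF, hcov⟩ := exists_coverFree_family (D := D) (m := m) hq (by omega)
    (hm.trans (Nat.pow_le_pow_left hsq.le _))
  refine ⟨q ^ 2, Nat.pow_le_pow_left hq2 2, fun S =>
    ⟨cons F (fun x _ => hF x) hcov S, rfl, rfl, ?_⟩⟩
  change ∑ i ∈ range (S.steps + 1), Nat.clog 2 ((cons F (fun x _ => hF x) hcov S).palette i) = _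
  rw [sum_range_succ', add_comm]
  rfl

/-- The end of the schedule: when `m` is bounded in terms of `D`, two steps reach `O(D ^ 2)`
colors. -/
lemma exists_of_clog_le (hD : 1 ≤ D) (hm : Nat.clog 2 m ≤ D) :
    ∃ S : LinialScheme D m, S.numColors ≤ 36 * D ^ 2 ∧ S.steps ≤ 2 ∧
      S.totalBits ≤ 2 * Nat.clog 2 m := by
  -- Cubic polynomials and a field size between `3 * D` and `6 * D`.
  have hlast : ∀ k ≤ 81 * D ^ 4, ∃ S : LinialScheme D k, S.numColors ≤ 36 * D ^ 2 ∧
      S.steps ≤ 1 ∧ S.totalBits ≤ Nat.clog 2 k := by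
    intro k hk
    obtain ⟨m', hm', h⟩ := exists_cons (D := D) (m := k) (s := 3 * D) (d := 3) (by omega) le_rfl
      (hk.trans (by rw [mul_pow]; norm_num))
    obtain ⟨S, h1, h2, h3⟩ := h (trivial D m')
    refine ⟨S, h1.le.trans (hm'.trans_eq (by ring)), h2.le, h3.le⟩
  rcases le_total m (81 * D ^ 4) with hk | hk
  · obtain ⟨S, h1, h2, h3⟩ := hlast m hk
    exact ⟨S, h1, by omega, by omega⟩
  · obtain ⟨m', hm', h⟩ := exists_cons (D := D) (m := m) (s := D * D) (d := Nat.clog 2 m)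
      (by positivity) (Nat.mul_le_mul_right D hm) (by
        rcases hD.eq_or_lt with rfl | hD
        · have := (Nat.clog_le_iff_le_pow (by norm_num)).1 hm
          omega
        · refine (Nat.le_pow_clog (by norm_num : 1 < 2) m).trans ?_
          exact Nat.pow_le_pow_left (by nlinarith : 2 ≤ D * D) _ |>.trans
            (Nat.pow_le_pow_right (by positivity) (Nat.le_succ _)))
    obtain ⟨S', h1', h2', h3'⟩ := hlast m' (hm'.trans (by
      have : (2 * (D * D)) ^ 2 = 4 * D ^ 4 := by ring
      omega))
    obtain ⟨S, h1, h2, h3⟩ := h S'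
    have h4 : Nat.clog 2 m' ≤ Nat.clog 2 m := Nat.clog_mono_right 2 (hm'.trans (le_trans (by
      have : (2 * (D * D)) ^ 2 = 4 * D ^ 4 := by ring
      omega) hk))
    exact ⟨S, h1.le.trans h1', by omega, by omega⟩

/-- One step from `m` to at most `4 (log m) ^ 4` colors, when `log m` exceeds `D`. -/
lemma exists_cons_of_lt_clog (hm : D < Nat.clog 2 m) (hm2 : 2 ≤ Nat.clog 2 m) :
    ∃ m' ≤ 4 * Nat.clog 2 m ^ 4, ∀ S : LinialScheme D m', ∃ S' : LinialScheme D m,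
      S'.numColors = S.numColors ∧ S'.steps = S.steps + 1 ∧
      S'.totalBits = Nat.clog 2 m + S.totalBits := by
  set L := Nat.clog 2 m with hL
  obtain ⟨m', hm', h⟩ := exists_cons (D := D) (m := m) (s := L * L) (d := L)
    (by positivity) (Nat.mul_le_mul_left L hm.le) (by
      refine (Nat.le_pow_clog (by norm_num : 1 < 2) m).trans ?_
      exact Nat.pow_le_pow_left (by nlinarith : 2 ≤ L * L) _ |>.trans
        (Nat.pow_le_pow_right (by positivity) (Nat.le_succ _)))
  exact ⟨m', hm'.trans_eq (by ring), h⟩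

/-- Linial's color reduction from `m` to `O(D ^ 2)` colors in `O(log* m)` steps. The palette sizes
fall so fast that the color lengths of all steps together are only `O(log m)`. -/
theorem exists_scheme : ∃ L₀ : ℕ, ∀ D, 1 ≤ D → ∀ m, ∃ S : LinialScheme D m,
    S.numColors ≤ 36 * D ^ 2 + 2 ^ L₀ ∧ S.steps ≤ 2 * logStar m + 3 ∧
      S.totalBits ≤ 3 * Nat.clog 2 m := by
  obtain ⟨L₁, hL₁⟩ := exists_forall_clog_pow_le
  obtain ⟨L₀, h1L₀, hL₀⟩ : ∃ L₀, 1 ≤ L₀ ∧ ∀ L, L₀ < L →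
      4 * Nat.clog 2 (4 * L ^ 4) ^ 4 ≤ L ∧ 2 * Nat.clog 2 (4 * L ^ 4) ≤ L :=
    ⟨L₁ + 1, by omega, fun L hL => hL₁ L (by omega)⟩
  refine ⟨L₀, fun D hD m => ?_⟩
  have hend : ∀ m, Nat.clog 2 m ≤ D ∨ Nat.clog 2 m ≤ L₀ → ∃ S : LinialScheme D m,
      S.numColors ≤ 36 * D ^ 2 + 2 ^ L₀ ∧ S.steps ≤ 2 ∧ S.totalBits ≤ 2 * Nat.clog 2 m := by
    rintro m (hm | hm)
    · obtain ⟨S, h1, h2, h3⟩ := exists_of_clog_le hD hm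
      exact ⟨S, h1.trans (Nat.le_add_right _ _), h2, h3⟩
    · refine ⟨trivial D m, ?_, Nat.zero_le _, Nat.zero_le _⟩
      have : m ≤ 2 ^ L₀ := (Nat.clog_le_iff_le_pow (by norm_num)).1 hm
      exact this.trans (Nat.le_add_left _ _)
  induction m using Nat.strong_induction_on with
  | _ m ih =>
    by_cases hm : Nat.clog 2 m ≤ D ∨ Nat.clog 2 m ≤ L₀
    · obtain ⟨S, h1, h2, h3⟩ := hend m hm
      exact ⟨S, h1, by omega, by omega⟩
    rw [not_or, not_le, not_le] at hm
    have hm1 : 1 < m := by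
      by_contra h
      rw [Nat.clog_of_right_le_one (by omega)] at hm
      omega
    obtain ⟨m₁, hm₁, hcons₁⟩ := exists_cons_of_lt_clog hm.1 (by omega)
    have hlog₁ := Nat.clog_mono_right 2 hm₁
    obtain ⟨hb1, hb2⟩ := hL₀ _ hm.2
    -- If another large step is possible, the two steps together lead below `clog m`, so that
    -- `log*` drops; both `clog m₁` and `clog m₂` have been halved.
    by_cases hmm : Nat.clog 2 m₁ ≤ D ∨ Nat.clog 2 m₁ ≤ L₀
    · obtain ⟨S₁, h1, h2, h3⟩ := hend m₁ hmm
      obtain ⟨S, g1, g2, g3⟩ := hcons₁ S₁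
      exact ⟨S, g1.le.trans h1, by omega, by omega⟩
    rw [not_or, not_le, not_le] at hmm
    obtain ⟨m₂, hm₂, hcons₂⟩ := exists_cons_of_lt_clog hmm.1 (by omega)
    have hlog₂ := Nat.clog_mono_right 2 hm₂
    obtain ⟨-, hb3⟩ := hL₀ _ hmm.2
    have hm₂' : m₂ ≤ Nat.clog 2 m :=
      hm₂.trans ((Nat.mul_le_mul_left 4 (Nat.pow_le_pow_left hlog₁ 4)).trans hb1)
    obtain ⟨S₂, h1, h2, h3⟩ := ih m₂ (hm₂'.trans_lt (clog_two_lt_self hm1))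
    obtain ⟨S₁, g1, g2, g3⟩ := hcons₂ S₂
    obtain ⟨S, f1, f2, f3⟩ := hcons₁ S₁
    have hstar := logStar_mono hm₂'
    rw [logStar_of_one_lt hm1]
    exact ⟨S, (f1.trans g1).le.trans h1, by omega, by omega⟩

end LinialScheme

/-! ### The selected neighbors -/

/-- In a list sorted by the key `κ`, fewer than `K` entries precede an entry of the first `K`. -/
lemma card_lt_of_mem_take {l : List ℕ} {κ : ℕ → ℕ} (hl : l.Pairwise (fun x y => κ x < κ y))
    {K u : ℕ} (hu : u ∈ l.take K) {A : Finset ℕ} (hA : ∀ x ∈ A, x ∈ l ∧ κ x < κ u) :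
    A.card < K := by
  have hsub : A ⊆ (l.take K).toFinset.erase u := by
    intro x hx
    obtain ⟨hxl, hxu⟩ := hA x hx
    rw [mem_erase, List.mem_toFinset]
    refine ⟨fun h => by simp [h] at hxu, ?_⟩
    rw [← List.take_append_drop K l, List.mem_append] at hxl
    rw [← List.take_append_drop K l, List.pairwise_append] at hl
    exact hxl.resolve_right fun h => absurd (hl.2.2 u hu x h) hxu.asymm
  have h1 := card_le_card hsub
  have h2 : u ∈ (l.take K).toFinset := List.mem_toFinset.2 hu
  rw [card_erase_of_mem h2] at h1
  have h3 := (List.toFinset_card_le (l.take K)).trans (List.length_take_le K l)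
  have h4 := card_pos.2 ⟨u, h2⟩
  omega

lemma mem_kNextModulo_imp {K i j : ℕ} {Γ : Finset ℕ} (h : j ∈ kNextModulo K i Γ) :
    j ∈ Γ ∧ j ≠ i := by
  have := List.mem_of_mem_take h
  simp only [List.mem_append, mem_sort, mem_filter] at this
  rcases this with h | h <;> exact ⟨h.1, by omega⟩

/-- Fewer than `K` neighbors lie, in the circular order, between `i` and one that it selects. -/
lemma card_lt_of_mem_kNextModulo {K i j m : ℕ} {Γ A : Finset ℕ} (hj : j ∈ kNextModulo K i Γ)
    (hm : ∀ x ∈ Γ, x < m) (hA : ∀ x ∈ A, x ∈ Γ ∧ x ≠ i ∧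
      (if i < x then x else x + m) < (if i < j then j else j + m)) : A.card < K := by
  -- Shifting the IDs below `i` by a bound `m` on all IDs turns the circular list into a sorted one.
  refine card_lt_of_mem_take (κ := fun x => if i < x then x else x + m) ?_ hj fun x hx => ?_
  · rw [List.pairwise_append]
    refine ⟨?_, ?_, ?_⟩
    · refine (sortedLT_sort _).pairwise.imp_of_mem fun {x y} hx hy hxy => ?_
      rw [mem_sort, mem_filter] at hx hy
      rwa [if_pos hx.2, if_pos hy.2]
    · refine (sortedLT_sort _).pairwise.imp_of_mem fun {x y} hx hy hxy => ?_
      rw [mem_sort, mem_filter] at hx hy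
      rw [if_neg hx.2.asymm, if_neg hy.2.asymm]
      omega
    · intro x hx y hy
      rw [mem_sort, mem_filter] at hx hy
      have := hm x hx.1
      rw [if_pos hx.2, if_neg hy.2.asymm]
      omega
  · obtain ⟨h1, h2, h3⟩ := hA x hx
    refine ⟨?_, h3⟩
    simp only [List.mem_append, mem_sort, mem_filter]
    rcases Nat.lt_or_gt_of_ne h2 with h | h
    · exact Or.inr ⟨h1, h⟩
    · exact Or.inl ⟨h1, h⟩

lemma card_toFinset_kNextModulo {K i : ℕ} {Γ : Finset ℕ} (hi : i ∉ Γ) :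
    (kNextModulo K i Γ).toFinset.card = min K Γ.card := by
  have hdisj : Disjoint (Γ.filter (fun j => i < j)) (Γ.filter (fun j => j < i)) :=
    disjoint_filter.2 fun x _ h1 h2 => absurd h1 h2.asymm
  have hunion : Γ.filter (fun j => i < j) ∪ Γ.filter (fun j => j < i) = Γ := by
    ext x
    simp only [mem_union, mem_filter]
    refine ⟨fun h => h.elim And.left And.left, fun h => ?_⟩
    have : x ≠ i := fun h' => hi (h' ▸ h)
    rcases Nat.lt_or_gt_of_ne this with h' | h'
    · exact Or.inr ⟨h, h'⟩
    · exact Or.inl ⟨h, h'⟩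
  have hnodup : ((Γ.filter (fun j => i < j)).sort (· ≤ ·) ++
      (Γ.filter (fun j => j < i)).sort (· ≤ ·)).Nodup := by
    refine (sort_nodup _ _).append (sort_nodup _ _) ?_
    intro x hx hy
    rw [mem_sort] at hx hy
    exact disjoint_left.1 hdisj hx hy
  rw [kNextModulo, List.toFinset_card_of_nodup (hnodup.sublist (List.take_sublist _ _)),
    List.length_take, List.length_append, length_sort, length_sort, ← card_union_of_disjoint hdisj,
    hunion]

/-- A greedy independent set: if every vertex of `W` has fewer than `K` neighbors in `W` that come
later in some order, then `W` contains an independent set of at least `|W| / K` vertices. -/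
lemma exists_indepSet_of_later_lt {V : Type*} (G : SimpleGraph V) (κ : V → ℕ) (K : ℕ)
    (W : Finset V)
    (hW : ∀ w ∈ W, ∀ A ⊆ W, (∀ x ∈ A, G.Adj w x ∧ κ w < κ x) → A.card < K)
    (hκ : Set.InjOn κ W) :
    ∃ T ⊆ W, G.IsIndepSet (T : Set V) ∧ W.card ≤ K * T.card := by
  classical
  induction W using Finset.strongInduction with
  | H W ih =>
    rcases W.eq_empty_or_nonempty with rfl | hne
    · exact ⟨∅, Subset.rfl, by simp, by simp⟩
    -- Take the first vertex and discard its neighbors, which are all later: fewer than `K`.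
    obtain ⟨w, hw, hmin⟩ := exists_min_image W κ hne
    set A := W.filter (fun x => G.Adj w x) with hA
    set W' := (W.erase w) \ A with hW'
    have hsub : W' ⊆ W := sdiff_subset.trans (erase_subset _ _)
    have hwW' : w ∉ W' := fun h => notMem_erase w W (mem_sdiff.1 h).1
    obtain ⟨T, hT, hind, hcard⟩ := ih W' ⟨hsub, fun h => hwW' (h hw)⟩
      (fun x hx B hB => hW x (hsub hx) B (hB.trans hsub)) (hκ.mono hsub)
    have hlt : A.card < K := by
      refine hW w hw A (filter_subset _ _) fun x hx => ?_
      rw [hA, mem_filter] at hx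
      refine ⟨hx.2, lt_of_le_of_ne (hmin x hx.1) fun h => ?_⟩
      exact hx.2.ne (hκ hw hx.1 h)
    have hwT : w ∉ T := fun h => hwW' (hT h)
    have hnadj : ∀ x ∈ T, ¬ G.Adj w x := fun x hx h =>
      (mem_sdiff.1 (hT hx)).2 (mem_filter.2 ⟨hsub (hT hx), h⟩)
    refine ⟨insert w T, insert_subset hw (hT.trans hsub), ?_, ?_⟩
    · rw [coe_insert]
      intro x hx y hy hxy
      rcases hx with rfl | hx <;> rcases hy with rfl | hy
      · exact absurd rfl hxy
      · exact hnadj y hy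
      · exact fun h => hnadj x hx h.symm
      · exact hind hx hy hxy
    · have h1 : (W.erase w).card ≤ W'.card + A.card := by
        have := le_card_sdiff A (W.erase w)
        rw [← hW'] at this
        omega
      rw [card_erase_of_mem hw] at h1
      rw [card_insert_of_notMem hwT, mul_add]
      omega

lemma card_le_neighborhoodIndependence {V : Type*} [Fintype V] (G : SimpleGraph V) {v : V}
    {S : Finset V} (hS : (S : Set V) ⊆ G.neighborSet v) (hind : G.IsIndepSet (S : Set V)) :
    S.card ≤ neighborhoodIndependence G := by
  refine le_csSup ⟨Fintype.card V, ?_⟩ ⟨v, S, hS, hind, rfl⟩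
  rintro k ⟨-, T, -, -, rfl⟩
  exact card_le_univ T

namespace Network

variable {V : Type*} [Fintype V] (N : Network V) (K : ℕ)

lemma mem_neighborIds {v : V} {i : ℕ} :
    i ∈ N.neighborIds v ↔ ∃ u, N.graph.Adj v u ∧ N.id u = i := by
  simp [neighborIds]

lemma mem_backup {v u : V} : u ∈ N.backup K v ↔
    N.active v = true ∧ N.id u ∈ kNextModulo K (N.id v) (N.neighborIds v) := by
  simp [backup]

variable {K} in
lemma adj_of_mem_backup {v u : V} (h : u ∈ N.backup K v) : N.graph.Adj v u := by
  obtain ⟨w, hw, hwu⟩ := N.mem_neighborIds.1 (mem_kNextModulo_imp ((N.mem_backup K).1 h).2).1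
  rwa [← N.id_injective hwu]

lemma image_backup (v : V) : (N.backup K v).image N.id =
    if N.active v = true then (kNextModulo K (N.id v) (N.neighborIds v)).toFinset else ∅ := by
  ext i
  by_cases hv : N.active v = true
  · rw [if_pos hv, List.mem_toFinset, mem_image]
    constructor
    · rintro ⟨u, hu, rfl⟩
      exact ((N.mem_backup K).1 hu).2
    · intro hi
      obtain ⟨u, -, rfl⟩ := N.mem_neighborIds.1 (mem_kNextModulo_imp hi).1
      exact ⟨u, (N.mem_backup K).2 ⟨hv, hi⟩, rfl⟩
  · rw [if_neg hv]
    simp [mem_backup, hv]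

lemma id_notMem_neighborIds (v : V) : N.id v ∉ N.neighborIds v := by
  intro h
  obtain ⟨u, hu, hid⟩ := N.mem_neighborIds.1 h
  exact hu.ne (N.id_injective hid).symm

lemma card_neighborIds (v : V) : (N.neighborIds v).card = (N.graph.neighborSet v).ncard := by
  classical
  rw [neighborIds, card_image_of_injective _ N.id_injective, ← Set.ncard_coe_finset]
  congr 1
  ext u
  simp

lemma card_backup {v : V} (hv : N.active v = true) (hK : K ≤ (N.graph.neighborSet v).ncard) :
    (N.backup K v).card = K := by
  rw [← card_image_of_injective _ N.id_injective, image_backup, if_pos hv,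
    card_toFinset_kNextModulo (N.id_notMem_neighborIds v), card_neighborIds, min_eq_left hK]

lemma card_backup_le (v : V) : (N.backup K v).card ≤ K := by
  rw [← card_image_of_injective _ N.id_injective, image_backup]
  split_ifs
  · exact (List.toFinset_card_le _).trans (List.length_take_le _ _)
  · simp

/-- A vertex is selected by at most `c * K` vertices: in the circular order that ends at `u`, each
vertex that selects `u` has fewer than `K` later neighbors among the others, so that a `K`-th part
of them is independent. -/
lemma card_filter_mem_backup_le {c m : ℕ} (hc : neighborhoodIndependence N.graph ≤ c)
    (hm : ∀ v, N.id v < m) (u : V) [DecidablePred fun w => u ∈ N.backup K w] :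
    (univ.filter (fun w => u ∈ N.backup K w)).card ≤ c * K := by
  set W := univ.filter (fun w => u ∈ N.backup K w) with hW
  -- The position in the circular order of IDs that begins just after `u` and ends before `u`.
  let κ : V → ℕ := fun w => if N.id u < N.id w then N.id w else N.id w + m
  have hκ : Function.Injective κ := by
    intro x y h
    have h1 := hm x
    have h2 := hm y
    refine N.id_injective ?_
    simp only [κ] at h
    split_ifs at h <;> omega
  obtain ⟨T, hT, hind, hcard⟩ := exists_indepSet_of_later_lt N.graph κ K W
    (fun w hw A hAW hA => by
      have hwu := (mem_filter.1 hw).2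
      have hne : N.id u ≠ N.id w := fun h => (N.adj_of_mem_backup hwu).ne (N.id_injective h).symm
      rw [← card_image_of_injective A N.id_injective]
      refine card_lt_of_mem_kNextModulo (m := m) ((N.mem_backup K).1 hwu).2 ?_ ?_
      · intro i hi
        obtain ⟨x, -, rfl⟩ := N.mem_neighborIds.1 hi
        exact hm x
      · intro i hi
        obtain ⟨x, hx, rfl⟩ := mem_image.1 hi
        obtain ⟨hadj, hlt⟩ := hA x hx
        have hxw : N.id x ≠ N.id w := fun h => hadj.ne (N.id_injective h).symm
        have hxu : N.id x ≠ N.id u := fun h =>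
          (N.adj_of_mem_backup (mem_filter.1 (hAW hx)).2).ne (N.id_injective h)
        refine ⟨N.mem_neighborIds.2 ⟨x, hadj, rfl⟩, hxw, ?_⟩
        have h1 := hm x
        have h2 := hm u
        have h3 := hm w
        simp only [κ] at hlt
        split_ifs at hlt ⊢ <;> omega)
    hκ.injOn
  have hTu : (T : Set V) ⊆ N.graph.neighborSet u := fun w hw =>
    (N.adj_of_mem_backup (mem_filter.1 (hT hw)).2).symm
  have := (card_le_neighborhoodIndependence N.graph hTu hind).trans hc
  rw [mul_comm]
  exact hcard.trans (Nat.mul_le_mul_left K this)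

lemma selectionGraph_adj {v u : V} : (N.selectionGraph K).Adj v u ↔
    u ∈ N.backup K v ∨ v ∈ N.backup K u := by
  rw [selectionGraph, SimpleGraph.fromRel_adj]
  refine ⟨And.right, fun h => ⟨?_, h⟩⟩
  exact h.elim (fun h => (N.adj_of_mem_backup h).ne) (fun h => (N.adj_of_mem_backup h).ne')

lemma adj_of_selectionGraph_adj {v u : V} (h : (N.selectionGraph K).Adj v u) :
    N.graph.Adj v u :=
  ((N.selectionGraph_adj K).1 h).elim N.adj_of_mem_backup fun h => (N.adj_of_mem_backup h).symm

open Classical in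
/-- The selection graph has maximum degree at most `(c + 1) * K`. -/
lemma card_selectionGraph_neighbors_le {c m : ℕ} (hc : neighborhoodIndependence N.graph ≤ c)
    (hm : ∀ v, N.id v < m) (v : V) :
    (univ.filter (fun u => (N.selectionGraph K).Adj v u)).card ≤ (c + 1) * K := by
  have : univ.filter (fun u => (N.selectionGraph K).Adj v u) =
      N.backup K v ∪ univ.filter (fun u => v ∈ N.backup K u) := by
    ext u
    simp [selectionGraph_adj]
  rw [this]
  refine (card_union_le _ _).trans ?_
  have h1 := N.card_backup_le K v
  have h2 := N.card_filter_mem_backup_le K hc hm v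
  rw [add_mul]
  omega

end Network

/-! ### The square of a graph -/

lemma edist_le_two_iff {V : Type*} {G : SimpleGraph V} {u v : V} (hne : u ≠ v) :
    G.edist u v ≤ 2 ↔ G.Adj u v ∨ ∃ w, G.Adj u w ∧ G.Adj w v := by
  constructor
  · intro h
    obtain ⟨p, hp⟩ := SimpleGraph.exists_walk_of_edist_ne_top
      (ne_top_of_le_ne_top (by simp) h : G.edist u v ≠ ⊤)
    rw [← hp] at h
    have hlen : p.length ≤ 2 := by exact_mod_cast h
    match p, hlen with
    | .nil, _ => exact absurd rfl hne
    | .cons h .nil, _ => exact Or.inl h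
    | .cons h (.cons h' .nil), _ => exact Or.inr ⟨_, h, h'⟩
    | .cons _ (.cons _ (.cons _ _)), hl => simp at hl
  · rintro (h | ⟨w, h1, h2⟩)
    · exact (SimpleGraph.edist_le h.toWalk).trans (by simp)
    · exact (SimpleGraph.edist_le (.cons h1 (.cons h2 .nil))).trans (by simp)

lemma hopGraph_two_adj {V : Type*} {G : SimpleGraph V} {u v : V} :
    (hopGraph G 2).Adj u v ↔ u ≠ v ∧ (G.Adj u v ∨ ∃ w, G.Adj u w ∧ G.Adj w v) := by
  change u ≠ v ∧ G.edist u v ≤ ((2 : ℕ) : ℕ∞) ↔ _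
  refine and_congr_right fun h => ?_
  exact_mod_cast edist_le_two_iff h

open Classical in
/-- Every vertex at distance at most `2` from `v` is a neighbor `w` of `v` or one of the at most
`Δ - 1` further neighbors of some `w`. -/
lemma card_hopGraph_two_neighbors_le {V : Type*} [Fintype V] {G : SimpleGraph V} {Δ : ℕ}
    (hG : ∀ v, (univ.filter (fun u => G.Adj v u)).card ≤ Δ) (v : V) :
    (univ.filter (fun u => (hopGraph G 2).Adj v u)).card ≤ Δ ^ 2 := by
  have hsub : univ.filter (fun u => (hopGraph G 2).Adj v u) ⊆
      (univ.filter (fun u => G.Adj v u)).biUnion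
        (fun w => insert w ((univ.filter (fun u => G.Adj w u)).erase v)) := by
    intro u hu
    obtain ⟨hne, h⟩ := hopGraph_two_adj.1 (mem_filter.1 hu).2
    simp only [mem_biUnion, mem_filter, mem_univ, true_and, mem_insert, mem_erase]
    rcases h with h | ⟨w, h1, h2⟩
    · exact ⟨u, h, Or.inl rfl⟩
    · exact ⟨w, h1, Or.inr ⟨hne.symm, h2⟩⟩
  refine (card_le_card hsub).trans ((card_biUnion_le_card_mul _ _ Δ fun w hw => ?_).trans ?_)
  · have hvw : v ∈ univ.filter (fun u => G.Adj w u) :=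
      mem_filter.2 ⟨mem_univ _, (mem_filter.1 hw).2.symm⟩
    refine (card_insert_le _ _).trans ?_
    rw [card_erase_of_mem hvw, Nat.sub_add_cancel (card_pos.2 ⟨v, hvw⟩)]
    exact hG w
  · rw [sq]
    exact Nat.mul_le_mul_right Δ (hG v)

/-! ### Correctness of the color reduction -/

namespace LinialScheme

variable {D m : ℕ} {V : Type*} [Fintype V]

open Classical in
/-- A vertex always finds a new color: the colors of its neighbors are at most `D` other colors, and
their sets do not cover its own. -/
lemma colorAfter_succ_mem (S : LinialScheme D m) {H : SimpleGraph V} {φ : V → ℕ} {i : ℕ}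
    (hi : i < S.steps) (hlt : ∀ v, S.colorAfter H φ i v < S.palette i)
    (hne : ∀ u v, H.Adj u v → S.colorAfter H φ i u ≠ S.colorAfter H φ i v)
    (hD : ∀ v, (univ.filter (fun u => H.Adj v u)).card ≤ D) (v : V) :
    S.colorAfter H φ (i + 1) v ∈ S.family i (S.colorAfter H φ i v) ∧
      ∀ u, H.Adj v u → S.colorAfter H φ (i + 1) v ∉ S.family i (S.colorAfter H φ i u) := by
  have hcov := S.cover_free i hi _ (hlt v)
    ((univ.filter (fun u => H.Adj v u)).image (S.colorAfter H φ i))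
    (fun x hx => by
      obtain ⟨u, -, rfl⟩ := mem_image.1 hx
      exact mem_range.2 (hlt u))
    (card_image_le.trans (hD v))
    (fun hx => by
      obtain ⟨u, hu, h⟩ := mem_image.1 hx
      exact hne v u (mem_filter.1 hu).2 h.symm)
  obtain ⟨x, hx, hxn⟩ := not_subset.1 hcov
  refine Nat.sInf_mem (s := {x | x ∈ S.family i (S.colorAfter H φ i v) ∧
    ∀ u, H.Adj v u → x ∉ S.family i (S.colorAfter H φ i u)}) ⟨x, hx, fun u hu hxu => hxn ?_⟩
  exact mem_biUnion.2 ⟨_, mem_image_of_mem _ (mem_filter.2 ⟨mem_univ u, hu⟩), hxu⟩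

open Classical in
/-- Every intermediate coloring is legal and uses the palette of its step. -/
lemma colorAfter_legal (S : LinialScheme D m) {H : SimpleGraph V} {φ : V → ℕ}
    (hlt : ∀ v, φ v < m) (hne : ∀ u v, H.Adj u v → φ u ≠ φ v)
    (hD : ∀ v, (univ.filter (fun u => H.Adj v u)).card ≤ D) :
    ∀ i ≤ S.steps, (∀ v, S.colorAfter H φ i v < S.palette i) ∧
      ∀ u v, H.Adj u v → S.colorAfter H φ i u ≠ S.colorAfter H φ i v := by
  intro i
  induction i with
  | zero =>
    intro _
    rw [S.palette_zero]
    exact ⟨hlt, hne⟩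
  | succ i ih =>
    intro hi
    obtain ⟨ih1, ih2⟩ := ih (by omega)
    have hmem := S.colorAfter_succ_mem (by omega) ih1 ih2 hD
    refine ⟨fun v => mem_range.1 (S.family_subset i (by omega) _ (ih1 v) (hmem v).1), ?_⟩
    intro u v huv h
    refine (hmem v).2 u huv.symm ?_
    rw [← h]
    exact (hmem u).1

end LinialScheme

/-! ### Exclusive use of memory -/

namespace Network

variable {V : Type*} [Fintype V] (N : Network V) (K : ℕ)

/-- Two vertices that may use the memory of the same vertex are at distance at most `2` in the
selection graph, so that a legal 2-hop coloring separates them. -/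
lemma eq_of_usesMemory {φ : V → ℕ} {α : ℕ} (hφ : IsHopColoring (N.selectionGraph K) 2 α φ)
    {v w u : V} (hvw : φ w = φ v) (hv : UsesMemory (N.backup K) v u)
    (hw : UsesMemory (N.backup K) w u) : w = v := by
  by_contra hne
  refine hφ.2 w v hne ((edist_le_two_iff hne).2 ?_) hvw
  simp only [selectionGraph_adj]
  rcases hv with rfl | hv <;> rcases hw with rfl | hw
  · exact absurd rfl hne
  · exact Or.inl (Or.inl hw)
  · exact Or.inl (Or.inr hv)
  · exact Or.inr ⟨u, Or.inl hw, Or.inr hv⟩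

lemma virtualMemory_eq {φ : V → ℕ} {α : ℕ} (hφ : IsHopColoring (N.selectionGraph K) 2 α φ)
    {v : V} (hv : N.active v = true) (hK : (N.backup K v).card = K) (M : ℕ) :
    virtualMemory (fun _ => M) (N.colorClass φ (φ v)) (N.backup K) v = M + K * M := by
  classical
  have hset : univ.filter (fun u => v ∈ N.colorClass φ (φ v) ∧ UsesMemory (N.backup K) v u ∧
      ∀ w ∈ N.colorClass φ (φ v), UsesMemory (N.backup K) w u → w = v) =
      insert v (N.backup K v) := by
    ext u
    simp only [mem_filter, mem_univ, true_and, mem_insert]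
    constructor
    · exact fun h => h.2.1
    · exact fun h => ⟨⟨hv, rfl⟩, h, fun w hw hwu => N.eq_of_usesMemory K hφ hw.2 h hwu⟩
  have hnot : v ∉ N.backup K v := fun h => (N.adj_of_mem_backup h).ne rfl
  rw [virtualMemory]
  simp only [sum_const, smul_eq_mul]
  have hcard : (insert v (N.backup K v)).card = K + 1 := by
    rw [card_insert_of_notMem hnot, hK]
  rw [← hset] at hcard
  rw [show M + K * M = (K + 1) * M by ring, ← hcard]


end Network

/-! ### Programs with long messages -/

open Classical in
/-- The words that reach `v`, by the ID of the sender, when each neighbor `u` sends `w u`; the empty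
word stands for no message. -/
noncomputable def Network.inbox {V : Type*} (N : Network V) (v : V) (w : V → List Bool) :
    ℕ → List Bool :=
  fun i => if h : ∃ u, N.graph.Adj v u ∧ N.id u = i then w h.choose else []

lemma Network.inbox_id {V : Type*} (N : Network V) {v u : V} (w : V → List Bool)
    (h : N.graph.Adj v u) : N.inbox v w (N.id u) = w u := by
  have hex : ∃ u', N.graph.Adj v u' ∧ N.id u' = N.id u := ⟨u, h, rfl⟩
  rw [Network.inbox, dif_pos hex, N.id_injective hex.choose_spec.2]

/-- An algorithm that works in phases. In each phase a node sends a word of any length to each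
neighbor, and updates its memory from the words that arrive. When all phases are over, a node sends
in each of the remaining rounds one message, which its memory and the number of the round
determine. -/
structure PhasedAlgorithm (Memory : Type) where
  start : LocalInput → Memory
  word : ℕ → Memory → ℕ → List Bool
  next : ℕ → Memory → (ℕ → List Bool) → Memory
  turn : ℕ → Memory → ℕ → Option (List Bool)
  selected : Memory → Finset ℕ
  color : Memory → ℕ

namespace PhasedAlgorithm

/-- The state of a node that executes a phased algorithm by short messages: the current phase, the
number of rounds spent in it, the memory at the beginning of the phase, and the parts of the words
of this phase that have arrived. -/
structure ChunkState (Memory : Type) where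
  phase : ℕ
  round : ℕ
  memory : Memory
  buffer : ℕ → List Bool

/-- The program that executes the first `Q` phases of `A` by messages of `b` bits, using `r k`
rounds for phase `k`: every word is cut into chunks of `b` bits. -/
abbrev toProgram {M : Type} (A : PhasedAlgorithm M) (Q : ℕ) (r : ℕ → ℕ) (b : ℕ) : NodeProgram where
  State := ChunkState M
  init x := ⟨0, 0, A.start x, fun _ => []⟩
  send s i :=
    if s.phase < Q then some (((A.word s.phase s.memory i).drop (s.round * b)).take b)
    else A.turn s.round s.memory i
  receive s msg :=
    if s.phase < Q then
      if s.round + 1 < r s.phase then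
        ⟨s.phase, s.round + 1, s.memory, fun i => s.buffer i ++ (msg i).getD []⟩
      else ⟨s.phase + 1, 0, A.next s.phase s.memory (fun i => s.buffer i ++ (msg i).getD []),
        fun _ => []⟩
    else ⟨s.phase, s.round + 1, s.memory, s.buffer⟩
  selected s := A.selected s.memory
  color s := A.color s.memory

variable {V : Type*} [Fintype V] {M : Type} (A : PhasedAlgorithm M) (N : Network V)
  (data : V → ℕ → List Bool)

/-- The memory of each node after `k` phases. -/
noncomputable def memoryAfter : ℕ → V → M
  | 0 => fun v => A.start ⟨N.id v, N.neighborIds v, N.active v, data v⟩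
  | k + 1 => fun v => A.next k (memoryAfter k v)
      (N.inbox v fun u => A.word k (memoryAfter k u) (N.id v))

variable {Q : ℕ} {r : ℕ → ℕ} {b : ℕ}

/-- Appending the chunk that arrives in round `j` of a phase prolongs the received part. -/
lemma inbox_take_append {v : V} {w : V → List Bool} {j : ℕ} (i : ℕ) :
    N.inbox v (fun u => (w u).take (j * b)) i ++ N.inbox v (fun u => ((w u).drop (j * b)).take b) i
      = N.inbox v (fun u => (w u).take ((j + 1) * b)) i := by
  unfold Network.inbox
  split_ifs
  · simp only [add_mul, one_mul, List.take_add]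
  · rfl

open Classical in
/-- One round of phase `k`. -/
lemma run_toProgram_succ {t k j : ℕ} (hk : k < Q)
    (h : ∀ v, (A.toProgram Q r b).run N data t v = (⟨k, j, A.memoryAfter N data k v,
      N.inbox v (fun u => (A.word k (A.memoryAfter N data k u) (N.id v)).take (j * b))⟩ :
        ChunkState M)) (v : V) :
    (A.toProgram Q r b).run N data (t + 1) v =
      if j + 1 < r k then (⟨k, j + 1, A.memoryAfter N data k v,
        N.inbox v (fun u => (A.word k (A.memoryAfter N data k u) (N.id v)).take ((j + 1) * b))⟩ :
        ChunkState M)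
      else ⟨k + 1, 0, A.next k (A.memoryAfter N data k v)
        (N.inbox v (fun u => (A.word k (A.memoryAfter N data k u) (N.id v)).take ((j + 1) * b))),
        fun _ => []⟩ := by
  have hbuf : ∀ i, N.inbox v
      (fun u => (A.word k (A.memoryAfter N data k u) (N.id v)).take (j * b)) i ++
      (if h : ∃ u, N.graph.Adj v u ∧ N.id u = i then
          some (((A.word k (A.memoryAfter N data k h.choose) (N.id v)).drop (j * b)).take b)
        else none : Option (List Bool)).getD [] = N.inbox v
      (fun u => (A.word k (A.memoryAfter N data k u) (N.id v)).take ((j + 1) * b)) i := by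
    intro i
    rw [← inbox_take_append]
    congr 1
    unfold Network.inbox
    split_ifs <;> rfl
  simp only [NodeProgram.run, h, if_pos hk]
  simp only [hbuf]

/-- At every time the program is either inside a phase, with the chunks of the earlier rounds of
this phase in its buffers, or it has executed all `Q` phases. -/
lemma run_toProgram (hr : ∀ k < Q, 0 < r k)
    (hlen : ∀ k < Q, ∀ v u, N.graph.Adj v u →
      (A.word k (A.memoryAfter N data k v) (N.id u)).length ≤ r k * b) (t : ℕ) :
    (∃ k j, k < Q ∧ j < r k ∧ t = ∑ i ∈ range k, r i + j ∧
      ∀ v, (A.toProgram Q r b).run N data t v = (⟨k, j, A.memoryAfter N data k v,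
        N.inbox v (fun u => (A.word k (A.memoryAfter N data k u) (N.id v)).take (j * b))⟩ :
        ChunkState M)) ∨
    (∑ i ∈ range Q, r i ≤ t ∧ ∀ v, (A.toProgram Q r b).run N data t v =
      (⟨Q, t - ∑ i ∈ range Q, r i, A.memoryAfter N data Q v, fun _ => []⟩ :
        ChunkState M)) := by
  have hnil : ∀ (v : V) (w : V → List Bool),
      (fun _ => []) = N.inbox v (fun u => (w u).take (0 * b)) := by
    intro v w
    funext i
    simp [Network.inbox]
  induction t with
  | zero =>
    rcases Nat.eq_zero_or_pos Q with rfl | hQ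
    · exact Or.inr ⟨by simp, fun v => by simp; rfl⟩
    · refine Or.inl ⟨0, 0, hQ, hr 0 hQ, by simp, fun v => ?_⟩
      rw [← hnil]
      rfl
  | succ t ih =>
    rcases ih with ⟨k, j, hk, hj, ht, h⟩ | ⟨ht, h⟩
    · have hsucc := A.run_toProgram_succ N data hk h
      by_cases hj' : j + 1 < r k
      · refine Or.inl ⟨k, j + 1, hk, hj', by omega, fun v => ?_⟩
        rw [hsucc, if_pos hj']
      have hsum : t + 1 = ∑ i ∈ range (k + 1), r i := by
        rw [sum_range_succ]
        omega
      have hstate : ∀ v, (A.toProgram Q r b).run N data (t + 1) v =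
          (⟨k + 1, 0, A.memoryAfter N data (k + 1) v, fun _ => []⟩ : ChunkState M) := by
        intro v
        rw [hsucc, if_neg hj', memoryAfter]
        congr 2
        funext i
        unfold Network.inbox
        split_ifs with hi
        -- The phase ends, and by then the whole word has arrived.
        · refine List.take_of_length_le ((hlen k hk _ _ hi.choose_spec.1.symm).trans ?_)
          exact Nat.mul_le_mul_right b (by omega)
        · rfl
      by_cases hk' : k + 1 < Q
      · refine Or.inl ⟨k + 1, 0, hk', hr _ hk', hsum, fun v => ?_⟩
        rw [hstate, ← hnil]
      · obtain rfl : Q = k + 1 := by omega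
        refine Or.inr ⟨hsum.ge, fun v => ?_⟩
        rw [hstate, hsum, Nat.sub_self]
    · refine Or.inr ⟨by omega, fun v => ?_⟩
      simp only [NodeProgram.run, h, Nat.succ_sub ht, lt_irrefl, if_false]

lemma run_toProgram_of_le (hr : ∀ k < Q, 0 < r k)
    (hlen : ∀ k < Q, ∀ v u, N.graph.Adj v u →
      (A.word k (A.memoryAfter N data k v) (N.id u)).length ≤ r k * b) {t : ℕ}
    (ht : ∑ i ∈ range Q, r i ≤ t) (v : V) :
    (A.toProgram Q r b).run N data t v =
      (⟨Q, t - ∑ i ∈ range Q, r i, A.memoryAfter N data Q v, fun _ => []⟩ : ChunkState M) := by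
  rcases A.run_toProgram N data hr hlen t with ⟨k, j, hk, hj, htk, -⟩ | ⟨-, h⟩
  · have h1 : ∑ i ∈ range (k + 1), r i ≤ ∑ i ∈ range Q, r i :=
      sum_le_sum_of_subset (range_subset_range.2 hk)
    rw [sum_range_succ] at h1
    omega
  · exact h v

/-- The messages have at most `b` bits if those after the last phase do. -/
lemma bandwidthLE_toProgram (hr : ∀ k < Q, 0 < r k)
    (hlen : ∀ k < Q, ∀ v u, N.graph.Adj v u →
      (A.word k (A.memoryAfter N data k v) (N.id u)).length ≤ r k * b)
    (hturn : ∀ j v i, ∀ w ∈ A.turn j (A.memoryAfter N data Q v) i, w.length ≤ b) :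
    (A.toProgram Q r b).BandwidthLE N data b := by
  intro t v u _ w hw
  rcases A.run_toProgram N data hr hlen t with ⟨k, j, hk, -, -, h⟩ | ⟨-, h⟩
  · simp only [NodeProgram.message, h, if_pos hk, Option.mem_some_iff] at hw
    rw [← hw]
    exact List.length_take_le _ _
  · simp only [NodeProgram.message, h, lt_irrefl, if_false] at hw
    exact hturn _ v _ w hw

end PhasedAlgorithm

/-! ### Sets of colors as messages -/

/-- A binary code for the nonempty sets of at most `s` colors below `p`, whose words have at most
`s * clog p` bits. -/
structure ColorSetCode (s p : ℕ) where
  enc : Finset ℕ → List Bool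
  dec : List Bool → Finset ℕ
  length_enc_le : ∀ A, (enc A).length ≤ s * Nat.clog 2 p
  dec_enc : ∀ A ⊆ range p, A.Nonempty → A.card ≤ s → dec (enc A) = A

/-- A nonempty set of at most `s` colors is the range of a sequence of `s` colors, and there are no
more such sequences than words of `s * clog p` bits. -/
lemma nonempty_colorSetCode (s p : ℕ) : Nonempty (ColorSetCode s p) := by
  classical
  have hcard : Fintype.card (Fin s → Fin p) ≤ Fintype.card (Fin (s * Nat.clog 2 p) → Bool) := by
    simp only [Fintype.card_fun, Fintype.card_fin, Fintype.card_bool]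
    rw [mul_comm, pow_mul]
    exact Nat.pow_le_pow_left (Nat.le_pow_clog (by norm_num) p) s
  obtain ⟨e⟩ := Function.Embedding.nonempty_of_card_le hcard
  let img : (Fin s → Fin p) → Finset ℕ := fun f => univ.image fun i => (f i : ℕ)
  refine ⟨⟨fun A => if h : ∃ f, img f = A then List.ofFn (e h.choose) else [],
    fun w => if h : ∃ f, List.ofFn (e f) = w then img h.choose else ∅, fun A => ?_, ?_⟩⟩
  · split_ifs <;> simp
  · intro A hA hne hAs
    have hex : ∃ f, img f = A := by
      have hcard : Fintype.card A ≤ Fintype.card (Fin s) := by simpa using hAs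
      obtain ⟨g⟩ := Function.Embedding.nonempty_of_card_le hcard
      have : Nonempty A := hne.to_subtype
      have hsurj := Function.invFun_surjective g.injective
      refine ⟨fun i => ⟨(Function.invFun g i : A), mem_range.1 (hA (Subtype.property _))⟩, ?_⟩
      ext x
      simp only [img, mem_image, mem_univ, true_and]
      constructor
      · rintro ⟨i, rfl⟩
        exact Subtype.property _
      · intro hx
        obtain ⟨i, hi⟩ := hsurj ⟨x, hx⟩
        exact ⟨i, by rw [hi]⟩
    have hex2 : ∃ f, List.ofFn (e f) = List.ofFn (e hex.choose) := ⟨_, rfl⟩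
    simp only [dif_pos hex, dif_pos hex2]
    rw [e.injective (List.ofFn_injective hex2.choose_spec)]
    exact hex.choose_spec

/-- A fixed code for color sets, the same at all nodes. -/
noncomputable def colorSetCode (s p : ℕ) : ColorSetCode s p :=
  Classical.choice (nonempty_colorSetCode s p)

/-! ### The program for Efficient-VM -/

/-- The IDs that a node selects by `K`-Next-Modulo, from its own knowledge. -/
def LocalInput.selectedIds (x : LocalInput) (K : ℕ) : Finset ℕ :=
  if x.active = true then (kNextModulo K x.id x.neighborIds).toFinset else ∅

/-- The memory of a node during Efficient-VM: its input, the IDs of its neighbors in the selection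
graph, its current color, and the colors in its closed neighborhood in the selection graph. -/
structure VMMemory where
  input : LocalInput
  links : Finset ℕ
  color : ℕ
  closeColors : Finset ℕ

/-- The colors that arrive over the edges of the selection graph. -/
noncomputable def VMMemory.received (s : VMMemory) {l p : ℕ} (code : ColorSetCode l p)
    (msg : ℕ → List Bool) : Finset ℕ :=
  s.links.biUnion fun i => code.dec (msg i)

/-- The number of colors in a word of phase `k + 1`. -/
def wordColors (Δ k : ℕ) : ℕ := if k % 2 = 0 then 1 else Δ + 1

/-- The bound for the length of the words of phase `k`. -/
def wordLength (Δ : ℕ) (palette : ℕ → ℕ) : ℕ → ℕ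
  | 0 => 1
  | k + 1 => wordColors Δ k * Nat.clog 2 (palette (k / 2))

open Classical in
/-- Efficient-VM in phases, for a selection graph of maximum degree at most `Δ`. In phase `0` every
node tells its neighbors which of them it selects. Step `i` of the color reduction takes two phases:
in phase `2 * i + 1` the nodes send their colors, and in phase `2 * i + 2` they send the colors of
their closed neighborhoods. A node that receives these knows the colors of all nodes at distance at
most `2`, together with its own color, which no other of these nodes has and which is left out. -/
noncomputable def vmAlgorithm {D m : ℕ} (S : LinialScheme D m) (K Δ : ℕ) :
    PhasedAlgorithm VMMemory where
  start x := ⟨x, ∅, x.id, ∅⟩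
  word
    | 0, s, i => [decide (i ∈ s.input.selectedIds K)]
    | k + 1, s, _ => (colorSetCode (wordColors Δ k) (S.palette (k / 2))).enc
        (if k % 2 = 0 then {s.color} else s.closeColors)
  next
    | 0, s, msg => { s with
        links := s.input.selectedIds K ∪ s.input.neighborIds.filter fun i => msg i = [true] }
    | k + 1, s, msg =>
        let colors := s.received (colorSetCode (wordColors Δ k) (S.palette (k / 2))) msg
        if k % 2 = 0 then { s with closeColors := insert s.color colors }
        else { s with color := sInf {x | x ∈ S.family (k / 2) s.color ∧
          ∀ y ∈ colors, y ≠ s.color → x ∉ S.family (k / 2) y} }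
  turn j s i :=
    if s.input.active = true ∧ s.color = j ∧ i ∈ s.input.selectedIds K then some (s.input.data i)
    else none
  selected s := s.input.selectedIds K
  color s := s.color

section

variable {D m : ℕ} (S : LinialScheme D m) (K Δ : ℕ)
variable {V : Type*} [Fintype V] (N : Network V) (data : V → ℕ → List Bool)

lemma length_vmAlgorithm_word_le (k : ℕ) (s : VMMemory) (i : ℕ) :
    ((vmAlgorithm S K Δ).word k s i).length ≤ wordLength Δ S.palette k := by
  cases k with
  | zero => exact le_rfl
  | succ k => exact ColorSetCode.length_enc_le _ _

lemma vmAlgorithm_input (k : ℕ) (v : V) :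
    ((vmAlgorithm S K Δ).memoryAfter N data k v).input =
      ⟨N.id v, N.neighborIds v, N.active v, data v⟩ := by
  induction k with
  | zero => rfl
  | succ k ih =>
    rw [← ih]
    cases k with
    | zero => rfl
    | succ k =>
      rw [PhasedAlgorithm.memoryAfter]
      simp only [vmAlgorithm]
      split_ifs <;> rfl

lemma selectedIds_vmAlgorithm (k : ℕ) (v : V) :
    ((vmAlgorithm S K Δ).memoryAfter N data k v).input.selectedIds K =
      (N.backup K v).image N.id := by
  rw [vmAlgorithm_input, Network.image_backup]
  rfl

open Classical in
lemma turn_vmAlgorithm (j k : ℕ) (v u : V) :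
    (vmAlgorithm S K Δ).turn j ((vmAlgorithm S K Δ).memoryAfter N data k v) (N.id u) =
      if N.active v = true ∧ ((vmAlgorithm S K Δ).memoryAfter N data k v).color = j ∧
        u ∈ N.backup K v then some (data v (N.id u)) else none := by
  have hin := vmAlgorithm_input S K Δ N data k v
  have hsel := selectedIds_vmAlgorithm S K Δ N data k v
  change (if _ ∧ _ ∧ _ then some _ else none) = _
  refine if_congr (and_congr ?_ (and_congr Iff.rfl ?_)) ?_ rfl
  · rw [hin]
  · rw [hsel, N.id_injective.mem_finset_image]
  · rw [hin]

open Classical in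
/-- After phase `0` each node knows its neighbors in the selection graph. -/
lemma vmAlgorithm_links_one (v : V) :
    ((vmAlgorithm S K Δ).memoryAfter N data 1 v).links =
      (univ.filter (fun u => (N.selectionGraph K).Adj v u)).image N.id := by
  have h0 : ∀ u, (⟨N.id u, N.neighborIds u, N.active u, data u⟩ : LocalInput).selectedIds K =
      (N.backup K u).image N.id := selectedIds_vmAlgorithm S K Δ N data 0
  have hmem : ∀ u w, N.id w ∈ (N.backup K u).image N.id ↔ w ∈ N.backup K u := fun u w =>
    N.id_injective.mem_finset_image
  change LocalInput.selectedIds ⟨N.id v, N.neighborIds v, N.active v, data v⟩ K ∪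
    (N.neighborIds v).filter (fun i =>
    N.inbox v (fun u => [decide (N.id v ∈ LocalInput.selectedIds
      ⟨N.id u, N.neighborIds u, N.active u, data u⟩ K)]) i = [true]) = _
  ext i
  simp only [h0, mem_union, mem_filter, mem_image, mem_univ, true_and, Network.selectionGraph_adj]
  constructor
  · rintro (⟨u, hu, rfl⟩ | ⟨hi, h⟩)
    · exact ⟨u, Or.inl hu, rfl⟩
    · obtain ⟨u, hu, rfl⟩ := N.mem_neighborIds.1 hi
      rw [N.inbox_id _ hu] at h
      refine ⟨u, Or.inr ((hmem _ _).1 ?_), rfl⟩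
      simpa using h
  · rintro ⟨u, hu | hu, rfl⟩
    · exact Or.inl ⟨u, hu, rfl⟩
    · have hadj := (N.adj_of_mem_backup hu).symm
      refine Or.inr ⟨N.mem_neighborIds.2 ⟨u, hadj, rfl⟩, ?_⟩
      rw [N.inbox_id _ hadj]
      simpa using ⟨v, hu, rfl⟩

lemma vmAlgorithm_links_succ (k : ℕ) (v : V) :
    ((vmAlgorithm S K Δ).memoryAfter N data (k + 1) v).links =
      ((vmAlgorithm S K Δ).memoryAfter N data 1 v).links := by
  induction k with
  | zero => rfl
  | succ k ih =>
    rw [← ih, PhasedAlgorithm.memoryAfter]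
    simp only [vmAlgorithm]
    split_ifs <;> rfl

open Classical in
lemma vmAlgorithm_links (k : ℕ) (v : V) :
    ((vmAlgorithm S K Δ).memoryAfter N data (k + 1) v).links =
      (univ.filter (fun u => (N.selectionGraph K).Adj v u)).image N.id :=
  (vmAlgorithm_links_succ S K Δ N data k v).trans (vmAlgorithm_links_one S K Δ N data v)

open Classical in
/-- What arrives over the selection graph in phase `k + 1`, when the words carry sets that the code
covers. -/
lemma received_vmAlgorithm (k : ℕ) (v : V) (X : V → Finset ℕ)
    (hX : ∀ u, X u = if k % 2 = 0 then
      {((vmAlgorithm S K Δ).memoryAfter N data (k + 1) u).color}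
      else ((vmAlgorithm S K Δ).memoryAfter N data (k + 1) u).closeColors)
    (hsub : ∀ u, X u ⊆ range (S.palette (k / 2))) (hne : ∀ u, (X u).Nonempty)
    (hcard : ∀ u, (X u).card ≤ wordColors Δ k) :
    VMMemory.received ((vmAlgorithm S K Δ).memoryAfter N data (k + 1) v)
      (colorSetCode (wordColors Δ k) (S.palette (k / 2)))
      (N.inbox v fun u => (vmAlgorithm S K Δ).word (k + 1)
        ((vmAlgorithm S K Δ).memoryAfter N data (k + 1) u) (N.id v)) =
      (univ.filter (fun u => (N.selectionGraph K).Adj v u)).biUnion X := by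
  rw [VMMemory.received, vmAlgorithm_links, image_biUnion]
  refine biUnion_congr rfl fun u hu => ?_
  rw [N.inbox_id _ (N.adj_of_selectionGraph_adj K (mem_filter.1 hu).2)]
  change ColorSetCode.dec _ (ColorSetCode.enc _ (if k % 2 = 0 then
      {((vmAlgorithm S K Δ).memoryAfter N data (k + 1) u).color}
      else ((vmAlgorithm S K Δ).memoryAfter N data (k + 1) u).closeColors)) = _
  rw [← hX]
  exact ColorSetCode.dec_enc _ _ (hsub u) (hne u) (hcard u)

open Classical in
/-- After the phases of `i` steps, the nodes have the colors of Linial's algorithm. -/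
lemma vmAlgorithm_color (hid : ∀ v, N.id v < m)
    (hΔ : ∀ v, (univ.filter (fun u => (N.selectionGraph K).Adj v u)).card ≤ Δ)
    (hD : ∀ v, (univ.filter (fun u => (hopGraph (N.selectionGraph K) 2).Adj v u)).card ≤ D) :
    ∀ i ≤ S.steps, ∀ v, ((vmAlgorithm S K Δ).memoryAfter N data (2 * i + 1) v).color =
      S.colorAfter (hopGraph (N.selectionGraph K) 2) N.id i v := by
  intro i
  induction i with
  | zero => exact fun _ v => rfl
  | succ i ih =>
    intro hi v
    have ih := ih (by omega)
    obtain ⟨hlt, hne⟩ := S.colorAfter_legal hid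
      (fun u v h => N.id_injective.ne h.ne) hD i (by omega)
    set φ := S.colorAfter (hopGraph (N.selectionGraph K) 2) N.id i with hφ
    have hmod : (2 * i) % 2 = 0 := by omega
    have hdiv : (2 * i) / 2 = i := by omega
    have hmod' : ¬ (2 * i + 1) % 2 = 0 := by omega
    have hdiv' : (2 * i + 1) / 2 = i := by omega
    have h1 : ∀ v, (vmAlgorithm S K Δ).memoryAfter N data (2 * i + 1 + 1) v =
        { (vmAlgorithm S K Δ).memoryAfter N data (2 * i + 1) v with
          closeColors := insert (φ v)
            ((univ.filter (fun u => (N.selectionGraph K).Adj v u)).biUnion fun u => {φ u}) } := by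
      intro v
      have hrec := received_vmAlgorithm S K Δ N data (2 * i) v (fun u => {φ u})
        (fun u => by rw [if_pos hmod, ih])
        (fun u => by rw [hdiv]; exact singleton_subset_iff.2 (mem_range.2 (hlt u)))
        (fun u => singleton_nonempty _) (fun u => by simp [wordColors])
      rw [PhasedAlgorithm.memoryAfter]
      change (if (2 * i) % 2 = 0 then _ else _) = _
      rw [if_pos hmod, hrec, ← ih v]
    have hrec := received_vmAlgorithm S K Δ N data (2 * i + 1) v (fun u => insert (φ u)
        ((univ.filter (fun w => (N.selectionGraph K).Adj u w)).biUnion fun w => {φ w}))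
      (fun u => by rw [if_neg hmod', h1])
      (fun u => by
        rw [hdiv']
        refine insert_subset (mem_range.2 (hlt u)) (biUnion_subset.2 fun w _ => ?_)
        exact singleton_subset_iff.2 (mem_range.2 (hlt w)))
      (fun u => insert_nonempty _ _)
      (fun u => by
        rw [wordColors, if_neg hmod']
        refine (card_insert_le _ _).trans (Nat.add_le_add_right ?_ 1)
        rw [biUnion_singleton]
        exact card_image_le.trans (hΔ u))
    have hcol : ((vmAlgorithm S K Δ).memoryAfter N data (2 * i + 1 + 1) v).color = φ v := by
      rw [h1]
      exact ih v
    rw [show 2 * (i + 1) + 1 = 2 * i + 1 + 1 + 1 by ring, PhasedAlgorithm.memoryAfter]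
    change VMMemory.color (if (2 * i + 1) % 2 = 0 then _ else _) = _
    rw [if_neg hmod', hrec, hcol]
    simp only [hdiv']
    rw [LinialScheme.colorAfter]
    congr 1
    ext x
    refine and_congr_right fun _ => ?_
    constructor
    · intro h u hu
      obtain ⟨-, hvu⟩ := hopGraph_two_adj.1 hu
      refine h _ ?_ (hne v u hu).symm
      rw [mem_biUnion]
      rcases hvu with hvu | ⟨w, hvw, hwu⟩
      · exact ⟨u, mem_filter.2 ⟨mem_univ _, hvu⟩, mem_insert_self _ _⟩
      · refine ⟨w, mem_filter.2 ⟨mem_univ _, hvw⟩, mem_insert_of_mem ?_⟩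
        exact mem_biUnion.2 ⟨u, mem_filter.2 ⟨mem_univ _, hwu⟩, mem_singleton_self _⟩
    · intro h y hy hyv
      simp only [mem_biUnion, mem_filter, mem_univ, true_and, mem_insert, mem_singleton] at hy
      rcases hy with ⟨u, hvu, rfl | ⟨w, huw, rfl⟩⟩
      · exact h u (hopGraph_two_adj.2 ⟨hvu.ne, Or.inl hvu⟩)
      · refine h w (hopGraph_two_adj.2 ⟨fun hvw => hyv (by rw [hvw]), Or.inr ⟨u, hvu, huw⟩⟩)

end

/-! ### The number of rounds -/

lemma sum_wordLength (Δ : ℕ) (palette : ℕ → ℕ) (s : ℕ) :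
    ∑ k ∈ range (2 * s + 1), wordLength Δ palette k =
      1 + (Δ + 2) * ∑ i ∈ range s, Nat.clog 2 (palette i) := by
  induction s with
  | zero => simp [wordLength]
  | succ s ih =>
    rw [show 2 * (s + 1) + 1 = 2 * s + 1 + 1 + 1 by ring, sum_range_succ, sum_range_succ, ih,
      sum_range_succ]
    have h1 : (2 * s) / 2 = s := by omega
    have h2 : (2 * s + 1) / 2 = s := by omega
    have h3 : (2 * s) % 2 = 0 := by omega
    have h4 : (2 * s + 1) % 2 = 1 := by omega
    simp only [wordLength, wordColors, h1, h2, h3, h4]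
    norm_num
    ring

/-- The number of rounds that phase `k` gets when messages have `b` bits. For `b = 0`, that is, for
networks of at most one node, the quotient is `0` and there is nothing to send. -/
def phaseRounds (Δ : ℕ) (palette : ℕ → ℕ) (b k : ℕ) : ℕ := 1 + wordLength Δ palette k / b

lemma phaseRounds_pos (Δ : ℕ) (palette : ℕ → ℕ) (b k : ℕ) : 0 < phaseRounds Δ palette b k :=
  Nat.add_pos_left one_pos _

lemma wordLength_le_phaseRounds_mul {Δ : ℕ} {palette : ℕ → ℕ} {b : ℕ} (hb : 0 < b) (k : ℕ) :
    wordLength Δ palette k ≤ phaseRounds Δ palette b k * b := by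
  rw [phaseRounds, add_mul, one_mul, mul_comm, add_comm]
  have := Nat.div_add_mod (wordLength Δ palette k) b
  have := Nat.mod_lt (wordLength Δ palette k) hb
  omega

/-- Long words cost `O(Δ)` rounds in all phases together, since all palettes together need only
`O(log n)` bits per color. -/
lemma sum_phaseRounds_le {D n a : ℕ} (S : LinialScheme D (n ^ a)) (Δ : ℕ)
    (hS : S.totalBits ≤ 3 * Nat.clog 2 (n ^ a)) :
    ∑ k ∈ range (2 * S.steps + 1), phaseRounds Δ S.palette (Nat.log 2 n) k ≤
      2 * S.steps + 2 + 6 * a * (Δ + 2) := by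
  set b := Nat.log 2 n with hb
  have hsum : ∑ k ∈ range (2 * S.steps + 1), wordLength Δ S.palette k / b ≤
      1 + 6 * a * (Δ + 2) := by
    rcases Nat.eq_zero_or_pos b with h0 | hpos
    · simp [h0]
    refine Nat.le_of_mul_le_mul_left ?_ hpos
    have hclog : Nat.clog 2 (n ^ a) ≤ 2 * a * b := by
      refine Nat.clog_le_of_le_pow ?_
      have h1 : n ≤ 2 ^ (2 * b) := (Nat.lt_pow_succ_log_self (by norm_num) n).le.trans
        (Nat.pow_le_pow_right (by norm_num) (by omega))
      calc n ^ a ≤ (2 ^ (2 * b)) ^ a := Nat.pow_le_pow_left h1 a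
        _ = 2 ^ (2 * a * b) := by rw [← pow_mul]; ring_nf
    calc b * ∑ k ∈ range (2 * S.steps + 1), wordLength Δ S.palette k / b
        ≤ ∑ k ∈ range (2 * S.steps + 1), wordLength Δ S.palette k := by
          rw [mul_sum]
          exact sum_le_sum fun k _ => Nat.mul_div_le _ _
      _ = 1 + (Δ + 2) * S.totalBits := sum_wordLength _ _ _
      _ ≤ b + (Δ + 2) * (6 * a * b) :=
          Nat.add_le_add hpos (Nat.mul_le_mul_left _ (hS.trans (by linarith)))
      _ = b * (1 + 6 * a * (Δ + 2)) := by ring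
  simp only [phaseRounds, sum_add_distrib, sum_const, card_range, smul_eq_mul, mul_one]
  omega

/-! ### Efficient-VM -/

lemma Network.vmColor_isHopColoring {V : Type*} [Fintype V] (N : Network V) (K : ℕ) {c m : ℕ}
    (S : LinialScheme (((c + 1) * K) ^ 2) m) (hid : ∀ v, N.id v < m)
    (hc : neighborhoodIndependence N.graph ≤ c) :
    IsHopColoring (N.selectionGraph K) 2 S.numColors (N.vmColor K S) := by
  obtain ⟨h1, h2⟩ := S.colorAfter_legal hid (fun u v h => N.id_injective.ne h.ne)
    (card_hopGraph_two_neighbors_le (N.card_selectionGraph_neighbors_le K hc hid)) S.steps le_rfl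
  exact ⟨h1, fun u v hne h => h2 u v ⟨hne, h⟩⟩

/-- Efficient-VM, executed by messages of `b` bits. -/
noncomputable def vmProgram {D m : ℕ} (S : LinialScheme D m) (K Δ b : ℕ) : NodeProgram :=
  (vmAlgorithm S K Δ).toProgram (2 * S.steps + 1) (phaseRounds Δ S.palette b) b

section

variable {V : Type*} [Fintype V] (N : Network V) (data : V → ℕ → List Bool) (K : ℕ) {D m : ℕ}
  (S : LinialScheme D m) (Δ : ℕ)

/-- The words of each phase fit into its rounds, since adjacent nodes exist only for `n ≥ 2`. -/
lemma length_word_le_phaseRounds_mul (k : ℕ) (v u : V) (h : N.graph.Adj v u) :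
    ((vmAlgorithm S K Δ).word k ((vmAlgorithm S K Δ).memoryAfter N data k v) (N.id u)).length ≤
      phaseRounds Δ S.palette (Nat.log 2 (Fintype.card V)) k * Nat.log 2 (Fintype.card V) := by
  refine (length_vmAlgorithm_word_le S K Δ k _ _).trans (wordLength_le_phaseRounds_mul ?_ k)
  exact Nat.log_pos (by norm_num) (Fintype.one_lt_card_iff.2 ⟨v, u, h.ne⟩)

lemma vmProgram_bandwidthLE
    (hdata : ∀ v i, (data v i).length ≤ Nat.log 2 (Fintype.card V)) :
    (vmProgram S K Δ (Nat.log 2 (Fintype.card V))).BandwidthLE N data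
      (Nat.log 2 (Fintype.card V)) := by
  refine PhasedAlgorithm.bandwidthLE_toProgram _ N data
    (fun k _ => phaseRounds_pos _ _ _ k)
    (fun k _ v u h => length_word_le_phaseRounds_mul N data K S Δ k v u h) fun j v i w hw => ?_
  simp only [vmAlgorithm] at hw
  split_ifs at hw
  · rw [Option.mem_some_iff] at hw
    rw [← hw]
    have hin := vmAlgorithm_input S K Δ N data (2 * S.steps + 1) v
    rw [vmAlgorithm] at hin
    rw [hin]
    exact hdata v i
  · simp at hw

open Classical in
lemma vmProgram_carriesOutVM (hid : ∀ v, N.id v < m)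
    (hΔ : ∀ v, (univ.filter (fun u => (N.selectionGraph K).Adj v u)).card ≤ Δ)
    (hD : ∀ v, (univ.filter (fun u => (hopGraph (N.selectionGraph K) 2).Adj v u)).card ≤ D) :
    (vmProgram S K Δ (Nat.log 2 (Fintype.card V))).CarriesOutVM N data K S
      (∑ k ∈ range (2 * S.steps + 1),
        phaseRounds Δ S.palette (Nat.log 2 (Fintype.card V)) k) := by
  have hr : ∀ k < 2 * S.steps + 1, 0 < phaseRounds Δ S.palette (Nat.log 2 (Fintype.card V)) k :=
    fun k _ => phaseRounds_pos _ _ _ k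
  have hlen := fun k (_ : k < 2 * S.steps + 1) v u h =>
    length_word_le_phaseRounds_mul N data K S Δ k v u h
  have hcolor : ∀ v, ((vmAlgorithm S K Δ).memoryAfter N data (2 * S.steps + 1) v).color =
      N.vmColor K S v := vmAlgorithm_color S K Δ N data hid hΔ hD S.steps le_rfl
  refine ⟨fun t _ v => ?_, fun t ht v => ?_, fun t v u ht _ => ?_⟩
  · rcases (vmAlgorithm S K Δ).run_toProgram N data hr hlen t with ⟨k, j, -, -, -, h⟩ | ⟨-, h⟩
    all_goals
      simp only [vmProgram, h]
      exact selectedIds_vmAlgorithm S K Δ N data _ v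
  · simp only [vmProgram, PhasedAlgorithm.run_toProgram_of_le _ N data hr hlen ht]
    exact hcolor v
  · simp only [vmProgram, NodeProgram.message,
      PhasedAlgorithm.run_toProgram_of_le _ N data hr hlen ht, lt_irrefl, if_false]
    rw [turn_vmAlgorithm, hcolor]
    simp only [Network.colorClass, Set.mem_ofPred_eq, and_assoc]

end

theorem theorem2 (c a : ℕ) :
    ∃ C B : ℕ, ∀ n K : ℕ, 1 ≤ K →
      ∃ (S : LinialScheme (((c + 1) * K) ^ 2) (n ^ a)) (P : NodeProgram) (T : ℕ),
        S.numColors ≤ C * K ^ 4 ∧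
        T + S.numColors ≤ C * (logStar n + K ^ 4) ∧
        ∀ (V : Type*) [Fintype V] (N : Network V) (data : V → ℕ → List Bool),
          Fintype.card V = n →
          (∀ v, N.id v < n ^ a) →
          (∀ v i, (data v i).length ≤ Nat.log 2 n) →
          neighborhoodIndependence N.graph ≤ c →
          (∀ v, N.active v = true → K ≤ (N.graph.neighborSet v).ncard) →
          P.BandwidthLE N data (B * Nat.log 2 n) ∧
          P.CarriesOutVM N data K S T ∧
          IsHopColoring (N.selectionGraph K) 2 S.numColors (N.vmColor K S) ∧
          ∀ v, N.active v = true →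
            (N.backup K v).card = K ∧
            (∀ u ∈ N.backup K v, N.graph.Adj v u) ∧
            (∀ u ∈ N.backup K v, ∀ w ∈ N.colorClass (N.vmColor K S) (N.vmColor K S v),
              UsesMemory (N.backup K) w u → w = v) ∧
            ∀ M : ℕ, virtualMemory (fun _ => M)
              (N.colorClass (N.vmColor K S) (N.vmColor K S v)) (N.backup K) v = M + K * M := by
  obtain ⟨L₀, hL₀⟩ := LinialScheme.exists_scheme
  -- Of this constant only its independence of `n` and `K` matters.
  generalize 2 ^ L₀ = E at hL₀
  refine ⟨24 + 4 * logStar a + 6 * a * (c + 3) + (36 * (c + 1) ^ 4 + E), 1, fun n K hK => ?_⟩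
  obtain ⟨S, hcolors, hsteps, hbits⟩ := hL₀ (((c + 1) * K) ^ 2)
    (Nat.one_le_pow _ _ (Nat.mul_pos (Nat.succ_pos c) hK)) (n ^ a)
  have hK4 : K ≤ K ^ 4 := Nat.le_self_pow (by norm_num) K
  have hnum : S.numColors ≤ (36 * (c + 1) ^ 4 + E) * K ^ 4 := by
    calc S.numColors ≤ 36 * (((c + 1) * K) ^ 2) ^ 2 + E * 1 := by rwa [mul_one]
      _ ≤ 36 * (((c + 1) * K) ^ 2) ^ 2 + E * K ^ 4 :=
          Nat.add_le_add_left (Nat.mul_le_mul_left E (hK.trans hK4)) _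
      _ = (36 * (c + 1) ^ 4 + E) * K ^ 4 := by ring
  have hrounds := sum_phaseRounds_le S ((c + 1) * K) hbits
  have hstar := logStar_pow_le n a
  refine ⟨S, vmProgram S K ((c + 1) * K) (Nat.log 2 n),
    ∑ k ∈ range (2 * S.steps + 1), phaseRounds ((c + 1) * K) S.palette (Nat.log 2 n) k,
    ?_, ?_, ?_⟩
  · exact hnum.trans (Nat.mul_le_mul_right _ (Nat.le_add_left _ _))
  · have h1 : 6 * a * ((c + 1) * K + 2) ≤ 6 * a * (c + 3) * K ^ 4 := by
      rw [mul_assoc (6 * a)]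
      refine Nat.mul_le_mul_left _ ?_
      nlinarith
    have h2 : (20 + 4 * logStar a) * 1 ≤ (20 + 4 * logStar a) * K ^ 4 :=
      Nat.mul_le_mul_left _ (hK.trans hK4)
    generalize K ^ 4 = k at *
    generalize 6 * a * (c + 3) = x at *
    generalize 36 * (c + 1) ^ 4 + E = y at *
    nlinarith [Nat.zero_le (logStar a * logStar n), Nat.zero_le (x * logStar n),
      Nat.zero_le (y * logStar n)]
  · intro V _ N data hn hid hdata hc hactive
    have hhop := N.vmColor_isHopColoring K S hid hc
    have hdeg := N.card_selectionGraph_neighbors_le K hc hid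
    subst hn
    refine ⟨?_, vmProgram_carriesOutVM N data K S _ hid hdeg (card_hopGraph_two_neighbors_le hdeg),
      hhop, fun v hv => ?_⟩
    · rw [one_mul]
      exact vmProgram_bandwidthLE N data K S _ hdata
    · have hcard := N.card_backup K hv (hactive v hv)
      exact ⟨hcard, fun u hu => N.adj_of_mem_backup hu,
        fun u hu w hw hwu => N.eq_of_usesMemory K hhop hw.2 (Or.inr hu) hwu,
        N.virtualMemory_eq K hhop hv hcard⟩
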